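/- **Setting.** Let $n,d,s$ be integers with $n\ge 1$ and $1\le s\le d$, let $r>0$, $\beta\ge 0$, $p\in[1,\infty]$. Let $\mathcal X=\{x\in\mathbb R^d:\max_j|x_j|\le r\}$ and let $\mathcal P^d(r,s)$ be the class of probability distributions $P$ on $\mathcal X$ whose mean $\theta(P)=\mathbb E_P[X]$ has at most $s$ nonzero coordinates. An estimator is a measurable map $\hat\theta:\mathcal X^n\times[0,1]\to\mathbb R^d$, $(\mathcal D_n,\xi)\mapsto\hat\theta(\mathcal D_n;\xi)$, with seed $\xi\sim\mathrm{Unif}[0,1]$ independent of the data. It is $\beta$-worst-case-stable if $\sup\mathbb E_\xi\|\hat\theta(\mathcal D_n;\xi)-\hat\theta(\mathcal D_n';\xi)\|_2\le\beta$, the supremum being over $\mathcal D_n,\mathcal D_n'\in\mathcal X^n$ that differ in at most one data point. It is $\beta$-$\ell_p$-stable if $$\Big\{\frac1{(n+1)^2}\sup_{\mathcal D\in\mathcal X^{n+1}}\sum_{i,j=1}^{n+1}\mathbb E_\xi\big\|\hat\theta(\mathcal D^{\setminus i};\xi)-\hat\theta(\mathcal D^{\setminus j};\xi)\big\|_2^p\Big\}^{1/p}\le\beta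 ,$$ where $\mathcal D^{\setminus i}$ is $\mathcal D$ with the $i$-th point deleted; for $p=\infty$ the condition is $\sup_{\mathcal D}\max_{i,j}\mathbb E_\xi\|\hat\theta(\mathcal D^{\setminus i};\xi)-\hat\theta(\mathcal D^{\setminus j};\xi)\|_2\le\beta$. Let $$R_{n,p}(\beta)=\inf_{\hat\theta\ \beta\text{-}\ell_p\text{-stable}}\ \sup_{P\in\mathcal P^d(r,s)}\mathbb E_{\mathcal D_n\sim P^{\otimes n},\,\xi}\|\hat\theta(\mathcal D_n;\xi)-\theta(P)\|_2^2 .$$ **Theorem 8.** There are universal constants $C,c>0$ and, for every $K>0$, a constant $c_K>0$ depending only on $K$, such that the following holds for all $n,d,s,r,\beta,p$ as above. 1. If $d\ge2$ and $\beta\ge4\sqrt2\,\frac{r\sqrt s}{n}$, then $R_{n,p}(\beta)\le C\,\frac{r^2s\log d}{n}$; and if moreover $\log d\le K\log(ed/s)$ and $\log d\le Kn$, then $R_{n,p}(\beta)\ge c_K\,\frac{r^2s\log d}{n}$. 2. If $\beta\le\frac1{16}\frac{r\sqrt s}{n}$, then $c\,r^2s\le R_{n,p}(\beta)\le C\,r^2s$.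 3. Both upper bounds are attained by the estimator $$\hat\theta_j=\Big(1\wedge\frac{n\beta}{4\sqrt{2s}\,r}\Big)\,\mathrm{sign}(\bar X_j)\,\big(|\bar X_j|-|\bar X|_{(s+1)}\big)_+,\qquad j=1,\dots,d,$$ where $\bar X$ is the sample mean and $|\bar X|_{(k)}$ is the $k$-th largest of $|\bar X_1|,\dots,|\bar X_d|$ (with $|\bar X|_{(d+1)}=0$). That is, for every $\beta\ge0$ it is measurable and it is both worst-case stable and $\ell_p$-stable at level $\min\{\beta,\,4\sqrt2\,r\sqrt s/n\}$ (in particular $\beta$-stable, and stable at a level that does not depend on $d$); its worst-case risk over $\mathcal P^d(r,s)$ is at most $C r^2s\log d/n$ when $d\ge2$ and $\beta\ge4\sqrt2\,r\sqrt s/n$, and at most $C r^2s$ when $\beta\le\frac1{16}r\sqrt s/n$. -/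

import Mathlib

open MeasureTheory
open scoped ENNReal unitInterval

noncomputable section

namespace StableMean

/-! ### Estimators, stability and stability-constrained minimax risk -/

section Framework

variable {𝒳 : Type*} {n d : ℕ}

/-- A (randomized) estimator of a parameter in `ℝ^d` from `n` data points in `𝒳`, with a random
seed `ξ ∈ [0,1]`. Measurability is imposed where estimators are quantified over. -/
abbrev Estimator (𝒳 : Type*) (n d : ℕ) : Type _ :=
  (Fin n → 𝒳) × I → EuclideanSpace ℝ (Fin d)

/-- The expected `p`-th power of the Euclidean distance between the outputs on the data sets
`D` and `D'`; the expectation is over the seed `ξ ∼ Unif[0,1]` only. -/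
def seedDist (T : Estimator 𝒳 n d) (p : ℝ) (D D' : Fin n → 𝒳) : ℝ≥0∞ :=
  ∫⁻ ξ : I, ‖T (D, ξ) - T (D', ξ)‖ₑ ^ p

open scoped Classical in
/-- Worst-case stability: the supremum, over data sets that differ in at most one data point, of
the expected change of the output is at most `β`. -/
def IsWorstCaseStable (T : Estimator 𝒳 n d) (β : ℝ) : Prop :=
  (⨆ (D : Fin n → 𝒳) (D' : Fin n → 𝒳) (_ : hammingDist D D' ≤ 1), seedDist T 1 D D')
    ≤ ENNReal.ofReal β

/-- `ℓ_p`-stability, for `p ∈ [1,∞]`. Here `i.removeNth D` is the data set `D` of size `n + 1`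
with its `i`-th data point deleted. -/
def IsLpStable (T : Estimator 𝒳 n d) (p : ℝ≥0∞) (β : ℝ) : Prop :=
  if p = ∞ then
    (⨆ (D : Fin (n + 1) → 𝒳) (i : Fin (n + 1)) (j : Fin (n + 1)),
      seedDist T 1 (i.removeNth D) (j.removeNth D)) ≤ ENNReal.ofReal β
  else
    ((((n : ℝ≥0∞) + 1) ^ 2)⁻¹ *
        (⨆ D : Fin (n + 1) → 𝒳, ∑ i : Fin (n + 1), ∑ j : Fin (n + 1),
          seedDist T p.toReal (i.removeNth D) (j.removeNth D))) ^ (1 / p.toReal)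
      ≤ ENNReal.ofReal β

variable [MeasurableSpace 𝒳]

/-- Mean-square risk `E ‖T(X₁,…,X_n; ξ) - t‖₂²`, with `X₁,…,X_n` i.i.d. from `P` and
`ξ ∼ Unif[0,1]` independent of the data. -/
def risk (T : Estimator 𝒳 n d) (P : ProbabilityMeasure 𝒳) (t : EuclideanSpace ℝ (Fin d)) :
    ℝ≥0∞ :=
  ∫⁻ z : (Fin n → 𝒳) × I, ‖T z - t‖ₑ ^ 2
    ∂((Measure.pi fun _ : Fin n => (P : Measure 𝒳)).prod volume)

/-- Worst-case mean-square risk over the class `Q`. -/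
def supRisk (Q : Set (ProbabilityMeasure 𝒳))
    (θ : ProbabilityMeasure 𝒳 → EuclideanSpace ℝ (Fin d)) (T : Estimator 𝒳 n d) : ℝ≥0∞ :=
  ⨆ P ∈ Q, risk T P (θ P)

/-- Stability-constrained minimax risk `R_{n,p}(θ(Q), β)`. -/
def minimaxRisk (n : ℕ) (p : ℝ≥0∞) (Q : Set (ProbabilityMeasure 𝒳))
    (θ : ProbabilityMeasure 𝒳 → EuclideanSpace ℝ (Fin d)) (β : ℝ) : ℝ≥0∞ :=
  ⨅ (T : Estimator 𝒳 n d) (_ : Measurable T) (_ : IsLpStable T p β), supRisk Q θ T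

end Framework

/-! ### The sparse mean model -/

section Sparse

variable {n d : ℕ} {r : ℝ}

/-- The `ℓ_∞` ball of radius `r` in `ℝ^d`, as the space of data points. -/
abbrev SupBall (d : ℕ) (r : ℝ) : Type :=
  {x : EuclideanSpace ℝ (Fin d) // ∀ j, |x j| ≤ r}

/-- The mean `E_P[X]`. -/
def mean (P : ProbabilityMeasure (SupBall d r)) : EuclideanSpace ℝ (Fin d) :=
  ∫ x : SupBall d r, (x : EuclideanSpace ℝ (Fin d)) ∂(P : Measure (SupBall d r))

/-- The number of nonzero coordinates of `v`. -/
def sparsity (v : EuclideanSpace ℝ (Fin d)) : ℕ :=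
  (Finset.univ.filter fun j => v j ≠ 0).card

/-- The class of distributions on the `ℓ_∞` ball of radius `r` with `s`-sparse mean. -/
def sparseClass (d : ℕ) (r : ℝ) (s : ℕ) : Set (ProbabilityMeasure (SupBall d r)) :=
  {P | sparsity (mean P) ≤ s}

/-- The stability-constrained minimax risk in the sparse mean model. -/
def sparseMinimaxRisk (n : ℕ) (p : ℝ≥0∞) (d : ℕ) (r : ℝ) (s : ℕ) (β : ℝ) : ℝ≥0∞ :=
  minimaxRisk n p (sparseClass d r s) mean β

/-- The `j`-th coordinate of the sample mean. -/
def sampleMean (D : Fin n → SupBall d r) (j : Fin d) : ℝ :=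
  (∑ i, (D i : EuclideanSpace ℝ (Fin d)) j) / n

/-- The `(k+1)`-th largest of the values `a_1, …, a_d` (with multiplicity), and `0` if there are
fewer than `k + 1` values. `Tuple.sort a` is a permutation that puts `a` in nondecreasing order;
`Fin.rev` reverses that order. -/
def succLargest (a : Fin d → ℝ) (k : ℕ) : ℝ :=
  if h : k < d then a (Tuple.sort a (Fin.rev ⟨k, h⟩)) else 0

/-- Soft-thresholding of the sample mean at the `(s+1)`-th largest absolute value of its
coordinates, scaled by `1 ∧ nβ / (4√(2s) r)`. -/
def softThreshold (n d : ℕ) (r : ℝ) (s : ℕ) (β : ℝ) : Estimator (SupBall d r) n d :=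
  fun z => WithLp.toLp 2 fun j =>
    min 1 (n * β / (4 * √(2 * s) * r)) *
      (Real.sign (sampleMean z.1 j) *
        max (|sampleMean z.1 j| - succLargest (fun k => |sampleMean z.1 k|) s) 0)

end Sparse

end StableMean

end

noncomputable section

namespace StableMean

/-! ### Order statistics and soft thresholding -/

section Threshold

variable {d : ℕ}

/-! Upper bounds. The (s+1)-th largest absolute value is 1-Lipschitz in the sup norm, so
soft-thresholding at that level moves each coordinate by at most twice the sup-norm change of the
sample mean. Exchanging or deleting a point changes the sample mean by at most 2r/n in sup norm, and
both outputs are s-sparse. The output therefore moves by at most √(2s) · 4r/n in Euclidean norm,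
free of d, and shrinkage brings this down to β (`norm_softThreshold_sub_le`). This holds pointwise
in data and seed, so every notion of stability follows. If θ is s-sparse, the threshold is at most
the sup-norm error of the sample mean, so without shrinkage the squared error is at most 8s times
the square of that error; Hoeffding's lemma and a union over coordinates give the logarithmic rate.
For any shrinkage the bound 8r²s is trivial.

Lower bound, large budget. Stability plays no role. Place s disjoint blocks of m = ⌊d/s⌋ coordinates
each. Independently in each block the mean is null with probability 1/2, and otherwise has one
uniformly chosen nonzero entry rv; the data are independent signs times r. Given the other blocks,
the likelihood ratio of each alternative to the null has second moment (1 + v²)^n. While this is at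
most 3m, the null and the mixture cannot be separated and the Bayes risk per block is of order (rv)²
(`bayes_risk_block`, `sum_config_block_ge`). The choice v² = min(1, log(em)/n) gives the rate.

Lower bound, small budget. Restrict to laws on the two points ± r a, with a the indicator of the
first s coordinates and q the probability of the plus sign. The derivative in q of the expectation
of ⟨a, T⟩ is a covariance with the score. Rewritten on a sample of size n + 1 and symmetrized, it
involves only differences between leave-one-out outputs (`sum_prod_bernWeight_score_le`), so
stability makes the expectation nearly constant in q. A risk below r²s/16 would force it to follow
⟨a, θ⟩ = rs(2q - 1) closely, which is a contradiction (`supRisk_ge_of_stable`). -/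

theorem card_succLargest_lt_le (a : Fin d → ℝ) (k : ℕ) :
    (Finset.univ.filter fun j => succLargest a k < a j).card ≤ k := by
  classical
  by_cases h : k < d
  · have hsub : (Finset.univ.filter fun j => succLargest a k < a j) ⊆
        ((Finset.range k).attachFin (fun i hi => (Finset.mem_range.1 hi).trans h)).image
          (fun i => Tuple.sort a (Fin.rev i)) := by
      intro j hj
      rw [Finset.mem_filter, succLargest, dif_pos h] at hj
      refine Finset.mem_image.2 ⟨Fin.rev ((Tuple.sort a).symm j), ?_, by simp⟩
      rw [Finset.mem_attachFin, Finset.mem_range]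
      by_contra hcon
      rw [not_lt] at hcon
      have hle : (Tuple.sort a).symm j ≤ Fin.rev ⟨k, h⟩ := by
        rw [Fin.le_rev_iff, Fin.le_def]
        exact hcon
      have := Tuple.monotone_sort a hle
      simp only [Function.comp_apply, Equiv.apply_symm_apply] at this
      exact absurd hj.2 (not_lt.2 this)
    refine (Finset.card_le_card hsub).trans (Finset.card_image_le.trans ?_)
    simp
  · refine (Finset.card_filter_le _ _).trans ?_
    simpa using h

/-- With `card_succLargest_lt_le`, this characterizes the order statistic of a nonnegative tuple as
the least t ≥ 0 exceeded by at most k entries, so later arguments avoid the sorting permutation. The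
sign condition on t covers the default value 0 for k ≥ d. -/
theorem succLargest_le {a : Fin d → ℝ} {k : ℕ} {t : ℝ} (ht : 0 ≤ t)
    (h : (Finset.univ.filter fun j => t < a j).card ≤ k) : succLargest a k ≤ t := by
  classical
  by_cases hk : k < d
  · by_contra hcon
    rw [not_le, succLargest, dif_pos hk] at hcon
    have hsub : ((Finset.range (k + 1)).attachFin
        (fun i hi => (Finset.mem_range.1 hi).trans_le hk)).image
          (fun i => Tuple.sort a (Fin.rev i)) ⊆ Finset.univ.filter fun j => t < a j := by
      intro j hj
      obtain ⟨i, hi, rfl⟩ := Finset.mem_image.1 hj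
      rw [Finset.mem_attachFin, Finset.mem_range] at hi
      refine Finset.mem_filter.2 ⟨Finset.mem_univ _, hcon.trans_le ?_⟩
      have hle : Fin.rev ⟨k, hk⟩ ≤ Fin.rev i := by
        rw [Fin.rev_le_rev, Fin.le_def]
        exact Nat.lt_succ_iff.1 hi
      exact Tuple.monotone_sort a hle
    have := Finset.card_le_card hsub
    rw [Finset.card_image_of_injective _ (show Function.Injective
      fun i => Tuple.sort a (Fin.rev i) from
        (Tuple.sort a).injective.comp Fin.rev_injective)] at this
    simp only [Finset.card_attachFin, Finset.card_range] at this
    omega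
  · rw [succLargest, dif_neg hk]
    exact ht

theorem succLargest_nonneg {a : Fin d → ℝ} (ha : ∀ j, 0 ≤ a j) (k : ℕ) :
    0 ≤ succLargest a k := by
  unfold succLargest
  split_ifs
  · exact ha _
  · exact le_rfl

/-- Entries of b above the raised level sit at indices where a exceeds its own level, and there are
at most k of these. -/
theorem succLargest_le_add {a b : Fin d → ℝ} {k : ℕ} {δ : ℝ} (ha : ∀ j, 0 ≤ a j)
    (h : ∀ j, b j ≤ a j + δ) (hδ : 0 ≤ δ) : succLargest b k ≤ succLargest a k + δ := by
  refine succLargest_le (add_nonneg (succLargest_nonneg ha k) hδ)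
    ((Finset.card_le_card fun j => ?_).trans (card_succLargest_lt_le a k))
  simp only [Finset.mem_filter, Finset.mem_univ, true_and]
  intro hj
  linarith [h j]

/-- Soft-thresholding of `x` at level `t`. -/
def soft (t x : ℝ) : ℝ := Real.sign x * max (|x| - t) 0

/-- A sign-free piecewise linear form; it makes the Lipschitz bound in both arguments a finite case
check. -/
theorem soft_eq {t : ℝ} (ht : 0 ≤ t) (x : ℝ) :
    soft t x = max (x - t) 0 + min (x + t) 0 := by
  unfold soft
  rcases lt_trichotomy x 0 with hx | rfl | hx
  · rw [Real.sign_of_neg hx, abs_of_neg hx, max_eq_right (by linarith : x - t ≤ 0)]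
    rcases le_total (-x - t) 0 with h | h
    · rw [max_eq_right h, min_eq_right (by linarith)]; ring
    · rw [max_eq_left h, min_eq_left (by linarith)]; ring
  · simp [ht]
  · rw [Real.sign_of_pos hx, abs_of_pos hx, min_eq_right (by linarith : 0 ≤ x + t)]; ring

theorem soft_zero (x : ℝ) : soft 0 x = x := by
  rw [soft_eq le_rfl]; simp

theorem abs_soft_sub_soft_le {t t' : ℝ} (ht : 0 ≤ t) (ht' : 0 ≤ t') (x x' : ℝ) :
    |soft t x - soft t' x'| ≤ |t - t'| + |x - x'| := by
  rw [soft_eq ht, soft_eq ht']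
  have h1 := neg_abs_le (t - t')
  have h2 := le_abs_self (t - t')
  have h3 := neg_abs_le (x - x')
  have h4 := le_abs_self (x - x')
  rw [abs_le]
  rcases max_cases (x - t) 0 with ⟨e1, _⟩ | ⟨e1, _⟩ <;>
  rcases max_cases (x' - t') 0 with ⟨e2, _⟩ | ⟨e2, _⟩ <;>
  rcases min_cases (x + t) 0 with ⟨e3, _⟩ | ⟨e3, _⟩ <;>
  rcases min_cases (x' + t') 0 with ⟨e4, _⟩ | ⟨e4, _⟩ <;>
  rw [e1, e2, e3, e4] <;> constructor <;> linarith

/-- Soft-thresholding of a vector at the `(s+1)`-th largest absolute value of its entries. -/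
def softVec (s : ℕ) (x : Fin d → ℝ) (j : Fin d) : ℝ :=
  soft (succLargest (fun k => |x k|) s) (x j)

theorem softVec_level_nonneg (s : ℕ) (x : Fin d → ℝ) :
    0 ≤ succLargest (fun k => |x k|) s :=
  succLargest_nonneg (fun _ => abs_nonneg _) s

theorem abs_softVec_le (s : ℕ) (x : Fin d → ℝ) (j : Fin d) : |softVec s x j| ≤ |x j| := by
  have h := softVec_level_nonneg s x
  unfold softVec soft
  rw [abs_mul, abs_of_nonneg (le_max_right (|x j| - _) 0)]
  have h1 : |Real.sign (x j)| ≤ 1 := by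
    rcases Real.sign_apply_eq (x j) with h | h | h <;> simp [h]
  calc _ ≤ 1 * max (|x j| - succLargest (fun k => |x k|) s) 0 := by gcongr
    _ ≤ |x j| := by
      rw [one_mul]
      exact max_le (by linarith) (abs_nonneg _)

theorem card_softVec_ne_zero_le (s : ℕ) (x : Fin d → ℝ) :
    (Finset.univ.filter fun j => softVec s x j ≠ 0).card ≤ s := by
  refine (Finset.card_le_card fun j => ?_).trans (card_succLargest_lt_le (fun k => |x k|) s)
  simp only [Finset.mem_filter, Finset.mem_univ, true_and]
  intro hj
  by_contra hcon
  rw [not_lt] at hcon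
  apply hj
  rw [softVec, soft, max_eq_right (by linarith), mul_zero]

theorem abs_succLargest_abs_sub_le {x y : Fin d → ℝ} {δ : ℝ} (hδ : 0 ≤ δ)
    (h : ∀ j, |x j - y j| ≤ δ) (s : ℕ) :
    |succLargest (fun k => |x k|) s - succLargest (fun k => |y k|) s| ≤ δ := by
  have h1 : succLargest (fun k => |x k|) s ≤ succLargest (fun k => |y k|) s + δ :=
    succLargest_le_add (fun _ => abs_nonneg _)
      (fun j => by linarith [abs_sub_abs_le_abs_sub (x j) (y j), h j]) hδ
  have h2 : succLargest (fun k => |y k|) s ≤ succLargest (fun k => |x k|) s + δ :=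
    succLargest_le_add (fun _ => abs_nonneg _)
      (fun j => by linarith [abs_sub_abs_le_abs_sub (y j) (x j), h j, abs_sub_comm (x j) (y j)]) hδ
  rw [abs_le]
  constructor <;> linarith

/-- One δ comes from the entry and one from the data-dependent level. -/
theorem abs_softVec_sub_softVec_le {x y : Fin d → ℝ} {δ : ℝ} (hδ : 0 ≤ δ)
    (h : ∀ j, |x j - y j| ≤ δ) (s : ℕ) (j : Fin d) :
    |softVec s x j - softVec s y j| ≤ 2 * δ := by
  refine (abs_soft_sub_soft_le (softVec_level_nonneg s x) (softVec_level_nonneg s y) _ _).trans ?_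
  linarith [abs_succLargest_abs_sub_le hδ h s, h j]

/-- The level of an s-sparse θ is 0, so that of x is at most δ; then compare with thresholding at 0,
which is the identity. -/
theorem abs_softVec_sub_le {x θ : Fin d → ℝ} {δ : ℝ} {s : ℕ} (hδ : 0 ≤ δ)
    (h : ∀ j, |x j - θ j| ≤ δ) (hθ : (Finset.univ.filter fun j => θ j ≠ 0).card ≤ s)
    (j : Fin d) : |softVec s x j - θ j| ≤ 2 * δ := by
  have hlev : succLargest (fun k => |x k|) s ≤ δ := by
    have h1 : succLargest (fun k => |θ k|) s ≤ 0 :=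
      succLargest_le le_rfl (by simpa only [abs_pos] using hθ)
    have h2 := (abs_le.1 (abs_succLargest_abs_sub_le hδ h s)).2
    linarith
  have h0 := softVec_level_nonneg s x
  have := abs_soft_sub_soft_le h0 le_rfl (x j) (θ j)
  rw [soft_zero, sub_zero, abs_of_nonneg h0] at this
  unfold softVec
  linarith [h j]

theorem continuous_softVec (s : ℕ) : Continuous (softVec s : (Fin d → ℝ) → Fin d → ℝ) := by
  refine (LipschitzWith.of_dist_le_mul (K := 2) fun x y => ?_).continuous
  refine (dist_pi_le_iff (by positivity)).2 fun j => ?_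
  rw [Real.dist_eq]
  exact abs_softVec_sub_softVec_le dist_nonneg
    (fun j => by rw [← Real.dist_eq]; exact dist_le_pi_dist x y j) s j

theorem sum_sq_le_card_mul {v : Fin d → ℝ} {B : ℝ} {k : ℕ} (hv : ∀ j, |v j| ≤ B)
    (hk : (Finset.univ.filter fun j => v j ≠ 0).card ≤ k) : ∑ j, v j ^ 2 ≤ k * B ^ 2 := by
  have h1 : ∑ j, v j ^ 2 = ∑ j ∈ Finset.univ.filter (fun j => v j ≠ 0), v j ^ 2 := by
    refine (Finset.sum_filter_of_ne fun j _ hj => ?_).symm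
    rintro h0
    exact hj (by rw [h0]; norm_num)
  rw [h1]
  calc _ ≤ ∑ j ∈ Finset.univ.filter (fun j => v j ≠ 0), B ^ 2 :=
        Finset.sum_le_sum fun j _ => by
          rw [← sq_abs]
          exact pow_le_pow_left₀ (abs_nonneg _) (hv j) 2
    _ ≤ k * B ^ 2 := by
        rw [Finset.sum_const, nsmul_eq_mul]
        gcongr

theorem card_sub_ne_zero_le {u v : Fin d → ℝ} {s : ℕ}
    (hu : (Finset.univ.filter fun j => u j ≠ 0).card ≤ s)
    (hv : (Finset.univ.filter fun j => v j ≠ 0).card ≤ s) :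
    (Finset.univ.filter fun j => u j - v j ≠ 0).card ≤ 2 * s := by
  classical
  have hsub : (Finset.univ.filter fun j => u j - v j ≠ 0) ⊆
      (Finset.univ.filter fun j => u j ≠ 0) ∪ Finset.univ.filter fun j => v j ≠ 0 := by
    intro j
    simp only [Finset.mem_filter, Finset.mem_univ, true_and, Finset.mem_union]
    intro h
    by_contra! hcon
    exact h (by rw [hcon.1, hcon.2, sub_zero])
  have := (Finset.card_le_card hsub).trans (Finset.card_union_le _ _)
  omega

end Threshold

/-! ### Stability and deterministic error bounds of the soft-thresholding estimator -/

section Estimator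

variable {n d : ℕ} {r : ℝ}

theorem softThreshold_apply (s : ℕ) (β : ℝ) (z : (Fin n → SupBall d r) × I) (j : Fin d) :
    softThreshold n d r s β z j =
      min 1 (n * β / (4 * √(2 * s) * r)) * softVec s (sampleMean z.1) j := rfl

theorem continuous_sampleMean :
    Continuous (sampleMean : (Fin n → SupBall d r) → Fin d → ℝ) := by
  unfold sampleMean
  fun_prop

theorem measurable_softThreshold (s : ℕ) (β : ℝ) : Measurable (softThreshold n d r s β) := by
  have h : Measurable fun z : (Fin n → SupBall d r) × I => softVec s (sampleMean z.1) :=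
    (continuous_softVec s).measurable.comp (continuous_sampleMean.measurable.comp measurable_fst)
  refine (WithLp.measurable_toLp 2 (Fin d → ℝ)).comp (measurable_pi_lambda _ fun j => ?_)
  exact ((measurable_pi_apply j).comp h).const_mul (min 1 (n * β / (4 * √(2 * s) * r)))

theorem norm_le_sqrt_card_mul {v : EuclideanSpace ℝ (Fin d)} {B : ℝ} {k : ℕ} (hB : 0 ≤ B)
    (hv : ∀ j, |v j| ≤ B) (hk : (Finset.univ.filter fun j => v j ≠ 0).card ≤ k) :
    ‖v‖ ≤ √k * B := by
  refine abs_le_of_sq_le_sq' ?_ (by positivity) |>.2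
  rw [EuclideanSpace.norm_sq_eq, mul_pow, Real.sq_sqrt (Nat.cast_nonneg k)]
  simpa only [Real.norm_eq_abs, sq_abs] using sum_sq_le_card_mul hv hk

theorem shrinkage_nonneg {s : ℕ} {β : ℝ} (hr : 0 < r) (hβ : 0 ≤ β) :
    0 ≤ min 1 (n * β / (4 * √(2 * s) * r)) := by positivity

theorem norm_softThreshold_sub_le {s : ℕ} {β : ℝ} (hn : 1 ≤ n) (hs : 1 ≤ s) (hr : 0 < r)
    (hβ : 0 ≤ β) (D D' : Fin n → SupBall d r)
    (h : ∀ j, |sampleMean D j - sampleMean D' j| ≤ 2 * r / n) (ξ : I) :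
    ‖softThreshold n d r s β (D, ξ) - softThreshold n d r s β (D', ξ)‖ ≤
      min β (4 * √2 * (r * √(s : ℝ) / n)) := by
  have hn' : (0 : ℝ) < n := by exact_mod_cast hn
  have hs' : (0 : ℝ) < s := by exact_mod_cast hs
  set a := min 1 (n * β / (4 * √(2 * s) * r)) with ha
  have ha0 : 0 ≤ a := shrinkage_nonneg hr hβ
  have h1 : ‖WithLp.toLp 2 fun j => softVec s (sampleMean D) j - softVec s (sampleMean D') j‖ ≤
      √((2 * s : ℕ) : ℝ) * (2 * (2 * r / n)) :=
    norm_le_sqrt_card_mul (by positivity)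
      (fun j => abs_softVec_sub_softVec_le (by positivity) h s j)
      (card_sub_ne_zero_le (card_softVec_ne_zero_le s _) (card_softVec_ne_zero_le s _))
  have h2 : softThreshold n d r s β (D, ξ) - softThreshold n d r s β (D', ξ) =
      a • WithLp.toLp 2 fun j => softVec s (sampleMean D) j - softVec s (sampleMean D') j := by
    ext j
    simp only [PiLp.sub_apply, PiLp.smul_apply, softThreshold_apply, smul_eq_mul, mul_sub, ha]
  rw [h2, norm_smul, Real.norm_of_nonneg ha0]
  push_cast at h1
  -- The shrinkage factor is the ratio of β to the unshrunk bound, capped at 1, so the product is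
  -- exactly the minimum.
  have h3 : a * (√(2 * s) * (2 * (2 * r / n))) = min β (4 * √2 * (r * √(s : ℝ) / n)) := by
    rw [ha, min_mul_of_nonneg _ _ (by positivity), min_comm]
    congr 1
    · field_simp
      norm_num
    · rw [Real.sqrt_mul (by norm_num)]
      ring
  exact (mul_le_mul_of_nonneg_left h1 ha0).trans h3.le

theorem abs_coord_sub_le (x y : SupBall d r) (j : Fin d) :
    |(x : EuclideanSpace ℝ (Fin d)) j - (y : EuclideanSpace ℝ (Fin d)) j| ≤ 2 * r := by
  have h1 := abs_le.1 (x.2 j)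
  have h2 := abs_le.1 (y.2 j)
  rw [abs_le]
  constructor <;> linarith

theorem abs_sampleMean_sub_le_of_hammingDist [DecidableEq (SupBall d r)] (hr : 0 < r) {D D' : Fin n → SupBall d r}
    (h : hammingDist D D' ≤ 1) (j : Fin d) :
    |sampleMean D j - sampleMean D' j| ≤ 2 * r / n := by
  rw [sampleMean, sampleMean, ← sub_div, abs_div, Nat.abs_cast, ← Finset.sum_sub_distrib]
  gcongr
  have h1 : ∑ i, ((D i : EuclideanSpace ℝ (Fin d)) j - (D' i : EuclideanSpace ℝ (Fin d)) j) =
      ∑ i ∈ Finset.univ.filter (fun i => D i ≠ D' i),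
        ((D i : EuclideanSpace ℝ (Fin d)) j - (D' i : EuclideanSpace ℝ (Fin d)) j) := by
    refine (Finset.sum_filter_of_ne fun i _ hi => ?_).symm
    intro h0
    exact hi (by rw [h0, sub_self])
  rw [h1]
  refine (Finset.abs_sum_le_sum_abs _ _).trans
    ((Finset.sum_le_sum fun i _ => abs_coord_sub_le (D i) (D' i) j).trans ?_)
  rw [Finset.sum_const, nsmul_eq_mul]
  have : ((Finset.univ.filter fun i => D i ≠ D' i).card : ℝ) ≤ 1 := by exact_mod_cast h
  nlinarith

/-- Each reduced sum is the full sum minus the deleted point, so the two differ by `D k - D i` only.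
-/
theorem abs_sampleMean_removeNth_sub_le (D : Fin (n + 1) → SupBall d r) (i k : Fin (n + 1))
    (j : Fin d) : |sampleMean (i.removeNth D) j - sampleMean (k.removeNth D) j| ≤ 2 * r / n := by
  rw [sampleMean, sampleMean, ← sub_div, abs_div, Nat.abs_cast]
  gcongr
  have h1 := Fin.sum_univ_succAbove (fun l => (D l : EuclideanSpace ℝ (Fin d)) j) i
  have h2 := Fin.sum_univ_succAbove (fun l => (D l : EuclideanSpace ℝ (Fin d)) j) k
  have h3 := abs_coord_sub_le (D k) (D i) j
  simp only [Fin.removeNth_apply]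
  refine le_of_eq_of_le (congrArg abs ?_) h3
  linarith

theorem seedDist_le_of_forall {𝒳 : Type*} {T : Estimator 𝒳 n d} {p b : ℝ} (hp : 0 ≤ p)
    {D D' : Fin n → 𝒳} (h : ∀ ξ, ‖T (D, ξ) - T (D', ξ)‖ ≤ b) :
    seedDist T p D D' ≤ ENNReal.ofReal b ^ p := by
  calc seedDist T p D D' ≤ ∫⁻ _ : I, ENNReal.ofReal b ^ p := by
        refine lintegral_mono fun ξ => ?_
        refine ENNReal.rpow_le_rpow ?_ hp
        rw [← ofReal_norm]
        exact ENNReal.ofReal_le_ofReal (h ξ)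
    _ = _ := by simp

theorem isWorstCaseStable_softThreshold {s : ℕ} {β : ℝ} (hn : 1 ≤ n) (hs : 1 ≤ s) (hr : 0 < r)
    (hβ : 0 ≤ β) : IsWorstCaseStable (softThreshold n d r s β)
      (min β (4 * √2 * (r * √(s : ℝ) / n))) := by
  refine iSup_le fun D => iSup_le fun D' => iSup_le fun h => ?_
  refine (seedDist_le_of_forall zero_le_one (norm_softThreshold_sub_le hn hs hr hβ D D'
    (abs_sampleMean_sub_le_of_hammingDist hr (by convert h)))).trans ?_
  rw [ENNReal.rpow_one]

theorem isLpStable_of_forall {𝒳 : Type*} {T : Estimator 𝒳 n d} {p : ℝ≥0∞} {b : ℝ} (hp : 1 ≤ p)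
    (h : ∀ (D : Fin (n + 1) → 𝒳) (i k : Fin (n + 1)) (ξ : I),
      ‖T (i.removeNth D, ξ) - T (k.removeNth D, ξ)‖ ≤ b) : IsLpStable T p b := by
  unfold IsLpStable
  split_ifs with hpt
  · refine iSup_le fun D => iSup_le fun i => iSup_le fun k => ?_
    simpa using seedDist_le_of_forall (T := T) zero_le_one (h D i k)
  · have hp1 : 1 ≤ p.toReal := by
      rw [← ENNReal.toReal_one]
      exact ENNReal.toReal_mono hpt hp
    have hp0 : 0 < p.toReal := by linarith
    have hsup : (⨆ D : Fin (n + 1) → 𝒳, ∑ i : Fin (n + 1), ∑ j : Fin (n + 1),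
          seedDist T p.toReal (i.removeNth D) (j.removeNth D)) ≤
        ((n : ℝ≥0∞) + 1) ^ 2 * ENNReal.ofReal b ^ p.toReal := by
      refine iSup_le fun D => ?_
      refine (Finset.sum_le_sum fun i _ => Finset.sum_le_sum fun k _ =>
        seedDist_le_of_forall hp0.le (h D i k)).trans_eq ?_
      simp only [Finset.sum_const, Finset.card_univ, Fintype.card_fin, nsmul_eq_mul]
      push_cast
      ring
    have hne : ((n : ℝ≥0∞) + 1) ^ 2 ≠ 0 := by positivity
    have hnt : ((n : ℝ≥0∞) + 1) ^ 2 ≠ ∞ := by finiteness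
    calc _ ≤ (ENNReal.ofReal b ^ p.toReal) ^ (1 / p.toReal) := by
          gcongr
          refine (mul_le_mul_right hsup _).trans_eq ?_
          rw [← mul_assoc, ENNReal.inv_mul_cancel hne hnt, one_mul]
      _ = _ := by rw [one_div, ENNReal.rpow_rpow_inv hp0.ne']

theorem IsLpStable.mono {𝒳 : Type*} {T : Estimator 𝒳 n d} {p : ℝ≥0∞} {b b' : ℝ}
    (h : IsLpStable T p b) (hb : b ≤ b') : IsLpStable T p b' := by
  unfold IsLpStable at *
  split_ifs at * <;> exact h.trans (ENNReal.ofReal_le_ofReal hb)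

theorem isLpStable_softThreshold {s : ℕ} {β : ℝ} {p : ℝ≥0∞} (hp : 1 ≤ p) (hn : 1 ≤ n)
    (hs : 1 ≤ s) (hr : 0 < r) (hβ : 0 ≤ β) : IsLpStable (softThreshold n d r s β) p
      (min β (4 * √2 * (r * √(s : ℝ) / n))) :=
  isLpStable_of_forall hp fun D i k ξ => norm_softThreshold_sub_le hn hs hr hβ _ _
    (abs_sampleMean_removeNth_sub_le D i k) ξ

theorem abs_sampleMean_le (hn : 1 ≤ n) (D : Fin n → SupBall d r) (j : Fin d) :
    |sampleMean D j| ≤ r := by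
  have hn' : (0 : ℝ) < n := by exact_mod_cast hn
  rw [sampleMean, abs_div, Nat.abs_cast, div_le_iff₀ hn']
  refine (Finset.abs_sum_le_sum_abs _ _).trans
    ((Finset.sum_le_sum fun i _ => (D i).2 j).trans_eq ?_)
  simp [mul_comm]

/-- A bound on the squared error that holds for every shrinkage factor. -/
theorem norm_softThreshold_sub_sq_le {s : ℕ} {β : ℝ} (hn : 1 ≤ n) (hr : 0 < r)
    (hβ : 0 ≤ β) {θ : EuclideanSpace ℝ (Fin d)} (hθ : sparsity θ ≤ s) (hθr : ∀ j, |θ j| ≤ r)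
    (z : (Fin n → SupBall d r) × I) :
    ‖softThreshold n d r s β z - θ‖ ^ 2 ≤ 8 * (r ^ 2 * s) := by
  rw [EuclideanSpace.norm_sq_eq]
  have ha0 : 0 ≤ min 1 (n * β / (4 * √(2 * s) * r)) := shrinkage_nonneg hr hβ
  have ha1 : min 1 (n * β / (4 * √(2 * s) * r)) ≤ 1 := min_le_left _ _
  have h1 : ∀ j, |softThreshold n d r s β z j| ≤ r := fun j => by
    rw [softThreshold_apply, abs_mul, abs_of_nonneg ha0]
    calc _ ≤ 1 * |softVec s (sampleMean z.1) j| := by gcongr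
      _ ≤ r := by
        rw [one_mul]
        exact (abs_softVec_le s _ j).trans (abs_sampleMean_le hn z.1 j)
  have h2 : (Finset.univ.filter fun j => softThreshold n d r s β z j ≠ 0).card ≤ s := by
    refine (Finset.card_le_card fun j => ?_).trans (card_softVec_ne_zero_le s (sampleMean z.1))
    rw [Finset.mem_filter, Finset.mem_filter, softThreshold_apply]
    exact fun h => ⟨h.1, right_ne_zero_of_mul h.2⟩
  have := sum_sq_le_card_mul (v := fun j => softThreshold n d r s β z j - θ j) (B := 2 * r)
    (fun j => (abs_sub _ _).trans (by linarith [h1 j, hθr j])) (card_sub_ne_zero_le h2 hθ)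
  push_cast at this
  simp only [PiLp.sub_apply, Real.norm_eq_abs, sq_abs]
  linarith

/-- Without shrinkage, the squared error is controlled by the sup-norm error of the sample
mean. -/
theorem norm_softThreshold_sub_sq_le_of_abs_le {s : ℕ} {β δ : ℝ} (hn : 1 ≤ n) (hs : 1 ≤ s)
    (hr : 0 < r) (hβ : 4 * √2 * (r * √(s : ℝ) / n) ≤ β) {θ : EuclideanSpace ℝ (Fin d)}
    (hθ : sparsity θ ≤ s) (z : (Fin n → SupBall d r) × I) (hδ : 0 ≤ δ)
    (h : ∀ j, |sampleMean z.1 j - θ j| ≤ δ) :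
    ‖softThreshold n d r s β z - θ‖ ^ 2 ≤ 8 * s * δ ^ 2 := by
  have hn' : (0 : ℝ) < n := by exact_mod_cast hn
  have hs' : (0 : ℝ) < s := by exact_mod_cast hs
  have ha : min 1 (n * β / (4 * √(2 * s) * r)) = 1 := by
    refine min_eq_left ?_
    rw [le_div_iff₀ (by positivity), Real.sqrt_mul (by norm_num)]
    calc _ = n * (4 * √2 * (r * √(s : ℝ) / n)) := by field_simp
      _ ≤ _ := by gcongr
  rw [EuclideanSpace.norm_sq_eq]
  have := sum_sq_le_card_mul (v := fun j => softVec s (sampleMean z.1) j - θ j) (B := 2 * δ)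
    (fun j => abs_softVec_sub_le hδ h hθ j) (card_sub_ne_zero_le (card_softVec_ne_zero_le s _) hθ)
  push_cast at this
  simp only [PiLp.sub_apply, softThreshold_apply, ha, one_mul, Real.norm_eq_abs, sq_abs]
  linarith

end Estimator

/-! ### Risk of the soft-thresholding estimator -/

section UpperBound

open ProbabilityTheory

variable {n d : ℕ} {r : ℝ}

theorem measurable_coord (j : Fin d) :
    Measurable fun x : SupBall d r => (x : EuclideanSpace ℝ (Fin d)) j := by
  have : Continuous fun x : SupBall d r => (x : EuclideanSpace ℝ (Fin d)) j := by fun_prop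
  exact this.measurable

theorem integrable_coe (P : ProbabilityMeasure (SupBall d r)) :
    Integrable (fun x : SupBall d r => (x : EuclideanSpace ℝ (Fin d)))
      (P : Measure (SupBall d r)) := by
  refine Integrable.of_bound measurable_subtype_coe.aestronglyMeasurable (√d * |r|)
    (Filter.Eventually.of_forall fun x => ?_)
  exact norm_le_sqrt_card_mul (abs_nonneg r) (fun j => (x.2 j).trans (le_abs_self r))
    ((Finset.card_filter_le _ _).trans (by simp))

theorem mean_apply (P : ProbabilityMeasure (SupBall d r)) (j : Fin d) :
    mean P j = ∫ x : SupBall d r, (x : EuclideanSpace ℝ (Fin d)) j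
      ∂(P : Measure (SupBall d r)) :=
  ((EuclideanSpace.proj (𝕜 := ℝ) j).integral_comp_comm (integrable_coe P)).symm

theorem abs_mean_le (P : ProbabilityMeasure (SupBall d r)) (j : Fin d) : |mean P j| ≤ r := by
  rw [mean_apply, ← Real.norm_eq_abs]
  refine (norm_integral_le_of_norm_le_const (C := r)
    (Filter.Eventually.of_forall fun x => x.2 j)).trans ?_
  simp

/-- Hoeffding's lemma on [-r, r], whose half-length is r. -/
theorem hasSubgaussianMGF_coord (hr : 0 < r) (P : ProbabilityMeasure (SupBall d r))
    (j : Fin d) :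
    HasSubgaussianMGF (fun x : SupBall d r => (x : EuclideanSpace ℝ (Fin d)) j - mean P j)
      (r.toNNReal ^ 2) (P : Measure (SupBall d r)) := by
  have h := hasSubgaussianMGF_of_mem_Icc (μ := (P : Measure (SupBall d r))) (a := -r) (b := r)
    (measurable_coord j).aemeasurable
    (Filter.Eventually.of_forall fun x => abs_le.1 (x.2 j))
  rw [← mean_apply] at h
  have hc : r.toNNReal ^ 2 = (‖r - -r‖₊ / 2) ^ 2 := by
    ext
    push_cast
    rw [Real.norm_of_nonneg (by linarith), Real.coe_toNNReal r hr.le]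
    ring
  rwa [hc]

theorem exp_mul_sampleMean_sub (hn : 1 ≤ n) (P : ProbabilityMeasure (SupBall d r)) (j : Fin d)
    (l : ℝ) (D : Fin n → SupBall d r) :
    Real.exp (l * (sampleMean D j - mean P j)) =
      ∏ i, Real.exp (l / n * ((D i : EuclideanSpace ℝ (Fin d)) j - mean P j)) := by
  have hn' : (0 : ℝ) < n := by exact_mod_cast hn
  rw [← Real.exp_sum, ← Finset.mul_sum, Finset.sum_sub_distrib, sampleMean]
  congr 1
  simp only [Finset.sum_const, Finset.card_univ, Fintype.card_fin, nsmul_eq_mul]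
  field_simp

theorem integrable_exp_sampleMean (hn : 1 ≤ n) (hr : 0 < r)
    (P : ProbabilityMeasure (SupBall d r)) (j : Fin d) (l : ℝ) :
    Integrable (fun D : Fin n → SupBall d r => Real.exp (l * (sampleMean D j - mean P j)))
      (Measure.pi fun _ : Fin n => (P : Measure (SupBall d r))) := by
  simp only [exp_mul_sampleMean_sub hn]
  exact Integrable.fintype_prod (μ := fun _ : Fin n => (P : Measure (SupBall d r)))
    (f := fun _ (x : SupBall d r) => Real.exp (l / n * ((x : EuclideanSpace ℝ (Fin d)) j - mean P j)))
    fun _ => (hasSubgaussianMGF_coord hr P j).integrable_exp_mul _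

theorem integral_exp_sampleMean_le (hn : 1 ≤ n) (hr : 0 < r)
    (P : ProbabilityMeasure (SupBall d r)) (j : Fin d) (l : ℝ) :
    ∫ D : Fin n → SupBall d r, Real.exp (l * (sampleMean D j - mean P j))
      ∂(Measure.pi fun _ : Fin n => (P : Measure (SupBall d r))) ≤
      Real.exp (l ^ 2 * r ^ 2 / (2 * n)) := by
  have hn' : (0 : ℝ) < n := by exact_mod_cast hn
  simp only [exp_mul_sampleMean_sub hn]
  rw [integral_fintype_prod_eq_prod
    (fun _ (x : SupBall d r) => Real.exp (l / n * ((x : EuclideanSpace ℝ (Fin d)) j - mean P j)))]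
  have h := (hasSubgaussianMGF_coord hr P j).mgf_le (l / n)
  rw [mgf] at h
  rw [Finset.prod_const, Finset.card_univ, Fintype.card_fin]
  refine (pow_le_pow_left₀ (integral_nonneg fun _ => (Real.exp_pos _).le) h n).trans_eq ?_
  rw [← Real.exp_nat_mul, NNReal.coe_pow, Real.coe_toNNReal r hr.le]
  congr 1
  field_simp

/-- For u = y - A ≥ 0, expand (A + u)² and use 1 + u + u²/2 ≤ exp u with A ≥ 1. A bound linear in
the exponential lets moment generating functions replace tail integration. -/
theorem sq_le_sq_add_exp {A y : ℝ} (hA : 1 ≤ A) (hy : 0 ≤ y) :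
    y ^ 2 ≤ A ^ 2 + 2 * A * Real.exp (y - A) := by
  rcases le_total A y with h | h
  · have := Real.quadratic_le_exp_of_nonneg (sub_nonneg.2 h)
    nlinarith [mul_nonneg (sub_nonneg.2 hA) (sq_nonneg (y - A))]
  · have := Real.exp_pos (y - A)
    nlinarith

theorem sq_le_mul_sq_add_exp_add_exp {A l z : ℝ} (hA : 1 ≤ A) (hl : 0 < l) :
    z ^ 2 ≤ (l ^ 2)⁻¹ *
      (A ^ 2 + 2 * A * Real.exp (-A) * (Real.exp (l * z) + Real.exp (-l * z))) := by
  have h := sq_le_sq_add_exp hA (abs_nonneg (l * z))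
  rw [sq_abs, mul_pow, sub_eq_neg_add, Real.exp_add] at h
  have h2 : Real.exp |l * z| ≤ Real.exp (l * z) + Real.exp (-l * z) := by
    rw [neg_mul]
    rcases abs_cases (l * z) with ⟨e, _⟩ | ⟨e, _⟩ <;> rw [e]
    · linarith [Real.exp_pos (-(l * z))]
    · linarith [Real.exp_pos (l * z)]
  have h3 : 2 * A * (Real.exp (-A) * Real.exp |l * z|) ≤
      2 * A * Real.exp (-A) * (Real.exp (l * z) + Real.exp (-l * z)) := by
    rw [← mul_assoc]
    gcongr
  rw [inv_mul_eq_div, le_div_iff₀ (by positivity)]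
  linarith

theorem risk_le_of_forall {T : Estimator (SupBall d r) n d} {P : ProbabilityMeasure (SupBall d r)}
    {t : EuclideanSpace ℝ (Fin d)} {g : (Fin n → SupBall d r) → ℝ} {B : ℝ}
    (h : ∀ z, ‖T z - t‖ ^ 2 ≤ g z.1)
    (hg : Integrable g (Measure.pi fun _ : Fin n => (P : Measure (SupBall d r))))
    (hB : ∫ D, g D ∂(Measure.pi fun _ : Fin n => (P : Measure (SupBall d r))) ≤ B) :
    risk T P t ≤ ENNReal.ofReal B := by
  have hg0 : ∀ D, 0 ≤ g D := fun D => (sq_nonneg _).trans (h (D, 0))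
  calc risk T P t ≤ ∫⁻ z : (Fin n → SupBall d r) × I, ENNReal.ofReal (g z.1)
          ∂((Measure.pi fun _ : Fin n => (P : Measure (SupBall d r))).prod volume) := by
        refine lintegral_mono fun z => ?_
        rw [← ofReal_norm, ← ENNReal.ofReal_pow (norm_nonneg _)]
        exact ENNReal.ofReal_le_ofReal (h z)
    _ = ∫⁻ D, ENNReal.ofReal (g D)
          ∂(Measure.pi fun _ : Fin n => (P : Measure (SupBall d r))) := by
        have hm := measurePreserving_fst
          (μ := Measure.pi fun _ : Fin n => (P : Measure (SupBall d r))) (ν := (volume : Measure I))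
        have h2 := lintegral_map' (f := fun D => ENNReal.ofReal (g D))
          (by rw [hm.map_eq]; exact hg.aestronglyMeasurable.aemeasurable.ennreal_ofReal)
          hm.measurable.aemeasurable
        rw [hm.map_eq] at h2
        exact h2.symm
    _ = ENNReal.ofReal (∫ D, g D
          ∂(Measure.pi fun _ : Fin n => (P : Measure (SupBall d r)))) :=
        (ofReal_integral_eq_lintegral_ofReal hg (Filter.Eventually.of_forall hg0)).symm
    _ ≤ _ := ENNReal.ofReal_le_ofReal hB

theorem supRisk_softThreshold_le_of_small {s : ℕ} {β : ℝ} (hn : 1 ≤ n) (hr : 0 < r)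
    (hβ : 0 ≤ β) : supRisk (sparseClass d r s) mean (softThreshold n d r s β) ≤
      ENNReal.ofReal (8 * (r ^ 2 * s)) :=
  iSup₂_le fun P hP => risk_le_of_forall
    (fun z => norm_softThreshold_sub_sq_le hn hr hβ hP (abs_mean_le P) z)
    (integrable_const _) (by simp)

theorem supRisk_softThreshold_le_of_large {s : ℕ} {β : ℝ} (hd : 2 ≤ d) (hn : 1 ≤ n) (hs : 1 ≤ s)
    (hr : 0 < r) (hβ : 4 * √2 * (r * √(s : ℝ) / n) ≤ β) :
    supRisk (sparseClass d r s) mean (softThreshold n d r s β) ≤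
      ENNReal.ofReal (64 * (r ^ 2 * s * Real.log d / n)) := by
  refine iSup₂_le fun P hP => ?_
  have hn' : (0 : ℝ) < n := by exact_mod_cast hn
  have hd' : (2 : ℝ) ≤ d := by exact_mod_cast hd
  set L := Real.log d with hL
  have hL2 : 0.6931 < L :=
    (by linarith [Real.log_two_gt_d9] : (0.6931 : ℝ) < Real.log 2).trans_le
      (Real.log_le_log (by norm_num) hd')
  -- With this l, each exponential moment exp(l²r²/(2n)) equals d. Taking A = 2 log d below makes
  -- exp(-A) = d⁻², which offsets the sum of 2d such moments.
  set l := √(2 * n * L / r ^ 2) with hl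
  have hl0 : 0 < l := by positivity
  have hlsq : l ^ 2 = 2 * n * L / r ^ 2 := Real.sq_sqrt (by positivity)
  set A := 2 * L with hA
  have hA1 : 1 ≤ A := by linarith
  have hexp : Real.exp L = d := Real.exp_log (by linarith)
  have hbound := fun (j : Fin d) (l' : ℝ) (h : l' ^ 2 = l ^ 2) =>
    (integral_exp_sampleMean_le hn hr P j l').trans_eq (b := Real.exp (l' ^ 2 * r ^ 2 / (2 * n)))
      (c := (d : ℝ)) (by
        rw [h, hlsq, ← hexp]
        congr 1
        field_simp)
  have hadd : ∀ j, Integrable (fun D : Fin n → SupBall d r =>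
      Real.exp (l * (sampleMean D j - mean P j)) + Real.exp (-l * (sampleMean D j - mean P j)))
      (Measure.pi fun _ : Fin n => (P : Measure (SupBall d r))) := fun j =>
    (integrable_exp_sampleMean hn hr P j l).add (integrable_exp_sampleMean hn hr P j (-l))
  have hint : Integrable (fun D : Fin n → SupBall d r =>
      ∑ j, (Real.exp (l * (sampleMean D j - mean P j)) +
        Real.exp (-l * (sampleMean D j - mean P j))))
      (Measure.pi fun _ : Fin n => (P : Measure (SupBall d r))) :=
    integrable_finsetSum _ fun j _ => hadd j
  have hsum : ∫ D : Fin n → SupBall d r,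
      ∑ j, (Real.exp (l * (sampleMean D j - mean P j)) +
        Real.exp (-l * (sampleMean D j - mean P j)))
      ∂(Measure.pi fun _ : Fin n => (P : Measure (SupBall d r))) ≤ d * (2 * d) := by
    rw [integral_finsetSum _ fun j _ => hadd j]
    refine (Finset.sum_le_sum fun j _ => ?_).trans_eq (b := ∑ _ : Fin d, (2 * d : ℝ)) (by simp)
    rw [integral_add (integrable_exp_sampleMean hn hr P j l)
      (integrable_exp_sampleMean hn hr P j (-l))]
    linarith [hbound j l rfl, hbound j (-l) (by ring)]
  refine risk_le_of_forall (g := fun D => 8 * s * ((l ^ 2)⁻¹ * (A ^ 2 + 2 * A * Real.exp (-A) *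
      ∑ j, (Real.exp (l * (sampleMean D j - mean P j)) +
        Real.exp (-l * (sampleMean D j - mean P j)))))) (fun z => ?_)
    ((((integrable_const _).add (hint.const_mul _)).const_mul _).const_mul _) ?_
  -- Summing the exponentials over all coordinates makes one B dominate every squared deviation,
  -- hence the squared sup norm.
  · set B := (l ^ 2)⁻¹ * (A ^ 2 + 2 * A * Real.exp (-A) *
      ∑ j, (Real.exp (l * (sampleMean z.1 j - mean P j)) +
        Real.exp (-l * (sampleMean z.1 j - mean P j)))) with hB
    have hB0 : 0 ≤ B := by positivity
    have h1 : ∀ j, |sampleMean z.1 j - mean P j| ≤ √B := fun j => by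
      refine Real.abs_le_sqrt ((sq_le_mul_sq_add_exp_add_exp hA1 hl0).trans ?_)
      rw [hB]
      gcongr
      exact Finset.single_le_sum (f := fun j => Real.exp (l * (sampleMean z.1 j - mean P j)) +
        Real.exp (-l * (sampleMean z.1 j - mean P j))) (fun j _ => by positivity)
        (Finset.mem_univ j)
    have h2 := norm_softThreshold_sub_sq_le_of_abs_le hn hs hr hβ hP z (Real.sqrt_nonneg B) h1
    rwa [Real.sq_sqrt hB0] at h2
  · rw [integral_const_mul, integral_const_mul,
      integral_add (integrable_const _) (hint.const_mul _), integral_const_mul]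
    simp only [integral_const, probReal_univ, one_smul]
    have hA' : Real.exp (-A) = ((d : ℝ) ^ 2)⁻¹ := by
      rw [Real.exp_neg, hA, two_mul, Real.exp_add, hexp, sq]
    have hd0 : (0 : ℝ) < d := by linarith
    calc _ ≤ 8 * s * ((l ^ 2)⁻¹ * (A ^ 2 + 2 * A * Real.exp (-A) * (d * (2 * d)))) := by gcongr
      _ = 8 * s * (r ^ 2 / n * (2 * L + 4)) := by
        rw [hA', hlsq, hA]
        field_simp
        ring
      -- This needs 4 ≤ 6L, true because L ≥ log 2 > 2/3.
      _ ≤ 8 * s * (r ^ 2 / n * (8 * L)) := by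
        gcongr
        linarith
      _ = _ := by ring

end UpperBound

/-! ### Finitely supported laws -/

section FiniteLaw

variable {𝒳 A : Type*} [MeasurableSpace 𝒳] [Fintype A] [MeasurableSpace A]
  [MeasurableSingletonClass A] {n d : ℕ}

/-- The law that puts mass `w a` on the point `x a`. -/
def finiteLaw (w : A → ℝ) (hw : ∀ a, 0 ≤ w a) (hw1 : ∑ a, w a = 1) (x : A → 𝒳) :
    ProbabilityMeasure 𝒳 :=
  ⟨Measure.map x (PMF.ofFintype (fun a => ENNReal.ofReal (w a))
      (by rw [← ENNReal.ofReal_sum_of_nonneg fun a _ => hw a, hw1, ENNReal.ofReal_one])).toMeasure,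
    Measure.isProbabilityMeasure_map (measurable_of_finite x).aemeasurable⟩

theorem risk_finiteLaw {w : A → ℝ} (hw : ∀ a, 0 ≤ w a) (hw1 : ∑ a, w a = 1) (x : A → 𝒳)
    {T : Estimator 𝒳 n d} (hT : Measurable T) (t : EuclideanSpace ℝ (Fin d)) :
    risk T (finiteLaw w hw hw1 x) t =
      ∑ D : Fin n → A, ENNReal.ofReal (∏ i, w (D i)) *
        ∫⁻ ξ : I, ‖T (fun i => x (D i), ξ) - t‖ₑ ^ 2 := by
  have hm : Measurable fun z : (Fin n → 𝒳) × I => ‖T z - t‖ₑ ^ 2 :=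
    (hT.sub_const t).enorm.pow_const 2
  have hm2 : Measurable fun D : Fin n → 𝒳 => ∫⁻ ξ : I, ‖T (D, ξ) - t‖ₑ ^ 2 :=
    hm.lintegral_prod_right'
  have hx : Measurable x := measurable_of_finite x
  have hxn : Measurable fun (D : Fin n → A) i => x (D i) :=
    measurable_pi_lambda _ fun i => hx.comp (measurable_pi_apply i)
  unfold risk finiteLaw
  rw [lintegral_prod _ hm.aemeasurable, ProbabilityMeasure.coe_mk]
  have := Measure.isProbabilityMeasure_map (μ := (PMF.ofFintype (fun a => ENNReal.ofReal (w a))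
      (by rw [← ENNReal.ofReal_sum_of_nonneg fun a _ => hw a, hw1,
        ENNReal.ofReal_one])).toMeasure) hx.aemeasurable
  rw [← Measure.pi_map_pi fun _ => hx.aemeasurable, lintegral_map hm2 hxn,
    lintegral_fintype]
  refine Finset.sum_congr rfl fun D _ => ?_
  rw [Measure.pi_singleton, mul_comm, ENNReal.ofReal_prod_of_nonneg fun i _ => hw _]
  congr 1
  refine Finset.prod_congr rfl fun i _ => ?_
  rw [PMF.toMeasure_apply_singleton _ _ (measurableSet_singleton _), PMF.ofFintype_apply]

theorem mean_finiteLaw_apply {r : ℝ} {w : A → ℝ} (hw : ∀ a, 0 ≤ w a) (hw1 : ∑ a, w a = 1)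
    (x : A → SupBall d r) (j : Fin d) :
    mean (finiteLaw w hw hw1 x) j = ∑ a, w a * (x a : EuclideanSpace ℝ (Fin d)) j := by
  have hx : Measurable x := measurable_of_finite x
  rw [mean_apply, finiteLaw, ProbabilityMeasure.coe_mk,
    integral_map hx.aemeasurable (measurable_coord j).aestronglyMeasurable, PMF.integral_eq_sum]
  refine Finset.sum_congr rfl fun a _ => ?_
  rw [PMF.ofFintype_apply, ENNReal.toReal_ofReal (hw a), smul_eq_mul]

end FiniteLaw

/-! ### Sign vectors with independent coordinates -/

section SignVector

variable {n d : ℕ}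

/-- The sign `±1` encoded by a Boolean. -/
def boolSign (b : Bool) : ℝ := if b then 1 else -1

theorem boolSign_sq (b : Bool) : boolSign b ^ 2 = 1 := by
  cases b <;> simp [boolSign]

theorem abs_boolSign (b : Bool) : |boolSign b| = 1 := by
  cases b <;> simp [boolSign]

/-- The probability of a sign vector with independent coordinates and mean `u`. -/
def signWeight (u : Fin d → ℝ) (ε : Fin d → Bool) : ℝ := ∏ k, (1 + u k * boolSign (ε k)) / 2

theorem one_add_mul_boolSign_nonneg {v : ℝ} (hv : |v| ≤ 1) (b : Bool) :
    0 ≤ 1 + v * boolSign b := by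
  have := abs_le.1 hv
  cases b <;> simp [boolSign] <;> linarith

theorem signWeight_nonneg {u : Fin d → ℝ} (hu : ∀ k, |u k| ≤ 1) (ε : Fin d → Bool) :
    0 ≤ signWeight u ε :=
  Finset.prod_nonneg fun k _ => by linarith [one_add_mul_boolSign_nonneg (hu k) (ε k)]

theorem sum_prod_bool (g : Fin d → Bool → ℝ) :
    ∑ ε : Fin d → Bool, ∏ k, g k (ε k) = ∏ k, (g k true + g k false) := by
  simp only [← Fintype.sum_bool, Finset.prod_univ_sum, Fintype.piFinset_univ]

theorem sum_signWeight (u : Fin d → ℝ) : ∑ ε, signWeight u ε = 1 := by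
  unfold signWeight
  rw [sum_prod_bool fun k b => (1 + u k * boolSign b) / 2]
  refine Finset.prod_eq_one fun k _ => ?_
  simp only [boolSign, if_true, Bool.false_eq_true, if_false]
  ring

theorem sum_signWeight_mul (u : Fin d → ℝ) (k : Fin d) :
    ∑ ε, signWeight u ε * boolSign (ε k) = u k := by
  have h : ∀ ε : Fin d → Bool, signWeight u ε * boolSign (ε k) =
      ∏ l, (1 + u l * boolSign (ε l)) / 2 * (if l = k then boolSign (ε l) else 1) := fun ε => by
    rw [Finset.prod_mul_distrib, Finset.prod_ite_eq' Finset.univ k, if_pos (Finset.mem_univ k),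
      signWeight]
  simp only [h]
  rw [sum_prod_bool fun l b => (1 + u l * boolSign b) / 2 * (if l = k then boolSign b else 1),
    Finset.prod_eq_single k]
  · simp only [boolSign, if_true, Bool.false_eq_true, if_false]
    ring
  · intro l _ hl
    simp only [boolSign, if_true, Bool.false_eq_true, if_false, hl]
    ring
  · exact fun h => absurd (Finset.mem_univ k) h

/-- A fair sign has weight 1/2 either way, so tilting coordinate k only multiplies the weight by one
factor. -/
theorem signWeight_update {u : Fin d → ℝ} {k : Fin d} (hk : u k = 0) (v : ℝ)
    (ε : Fin d → Bool) : signWeight (Function.update u k v) ε =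
      signWeight u ε * (1 + v * boolSign (ε k)) := by
  unfold signWeight
  rw [← Finset.mul_prod_erase _ _ (Finset.mem_univ k),
    ← Finset.mul_prod_erase (a := k) (f := fun k => (1 + u k * boolSign (ε k)) / 2) _
      (Finset.mem_univ k), hk, Function.update_self]
  have : ∏ l ∈ Finset.univ.erase k, (1 + Function.update u k v l * boolSign (ε l)) / 2 =
      ∏ l ∈ Finset.univ.erase k, (1 + u l * boolSign (ε l)) / 2 :=
    Finset.prod_congr rfl fun l hl => by
      rw [Function.update_of_ne (Finset.ne_of_mem_erase hl)]
  rw [this]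
  ring

/-- The likelihood ratio of `n` independent signs of mean `v` to `n` independent fair signs. -/
def likelihoodRatio (v : ℝ) (k : Fin d) (D : Fin n → Fin d → Bool) : ℝ :=
  ∏ i, (1 + v * boolSign (D i k))

theorem prod_signWeight_update {u : Fin d → ℝ} {k : Fin d} (hk : u k = 0) (v : ℝ)
    (D : Fin n → Fin d → Bool) : ∏ i, signWeight (Function.update u k v) (D i) =
      (∏ i, signWeight u (D i)) * likelihoodRatio v k D := by
  simp only [signWeight_update hk, Finset.prod_mul_distrib, likelihoodRatio]

theorem sum_mul_likelihoodRatio {u : Fin d → ℝ} {k : Fin d} (hk : u k = 0) (v : ℝ) :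
    ∑ D : Fin n → Fin d → Bool, (∏ i, signWeight u (D i)) * likelihoodRatio v k D = 1 := by
  simp only [← prod_signWeight_update hk]
  rw [← Fintype.sum_pow, sum_signWeight, one_pow]

/-- Sample points factor, and for one fair sign the cross term of (1 + vε)² averages to zero. -/
theorem sum_mul_likelihoodRatio_sq {u : Fin d → ℝ} {k : Fin d} (hk : u k = 0) (v : ℝ) :
    ∑ D : Fin n → Fin d → Bool, (∏ i, signWeight u (D i)) * likelihoodRatio v k D ^ 2 =
      (1 + v ^ 2) ^ n := by
  simp only [likelihoodRatio, ← Finset.prod_pow, ← Finset.prod_mul_distrib]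
  rw [← Fintype.sum_pow fun ε => signWeight u ε * (1 + v * boolSign (ε k)) ^ 2]
  congr 1
  have h : ∀ ε, signWeight u ε * (1 + v * boolSign (ε k)) ^ 2 =
      (1 + v ^ 2) * signWeight u ε + 2 * v * (signWeight u ε * boolSign (ε k)) := fun ε => by
    linear_combination signWeight u ε * v ^ 2 * boolSign_sq (ε k)
  simp only [h, Finset.sum_add_distrib, ← Finset.mul_sum, sum_signWeight, sum_signWeight_mul, hk]
  ring

end SignVector

/-! ### A Bayes risk bound for sparse means, without stability constraints -/

section BayesBlock

/-- Minimizing over a gives δ² w/(1 + w). The quadratic touches w/(1 + w) at w = 3, the gap being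
proportional to w(w - 3)²/(1 + w); being quadratic, it can be averaged from two moments of the
likelihood ratio. -/
theorem sq_add_mul_sub_sq_ge {w : ℝ} (hw : 0 ≤ w) (a δ : ℝ) :
    δ ^ 2 * ((7 * w - w ^ 2) / 16) ≤ a ^ 2 + w * (δ - a) ^ 2 := by
  have h1 : (7 * w - w ^ 2) / 16 ≤ w / (1 + w) := by
    rw [div_le_div_iff₀ (by norm_num) (by linarith)]
    nlinarith [mul_nonneg hw (sq_nonneg (w - 3))]
  have h2 : δ ^ 2 * (w / (1 + w)) ≤ a ^ 2 + w * (δ - a) ^ 2 := by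
    rw [← mul_div_assoc, div_le_iff₀ (by linarith)]
    nlinarith [sq_nonneg (a * (1 + w) - w * δ)]
  exact (mul_le_mul_of_nonneg_left h1 (sq_nonneg δ)).trans h2

/-- Bayes risk within a block: the mean vector is either null, or has the value `δ` at a single
uniformly distributed coordinate. -/
theorem bayes_risk_block {Ω : Type*} [Fintype Ω] {m : ℕ} (hm : 1 ≤ m) {Q : Ω → ℝ}
    (hQ : ∀ ω, 0 ≤ Q ω) {L : Fin m → Ω → ℝ} (hL : ∀ j ω, 0 ≤ L j ω)
    (hL1 : ∀ j, ∑ ω, Q ω * L j ω = 1) (hL2 : ∀ j, ∑ ω, Q ω * L j ω ^ 2 ≤ 3 * m)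
    (τ : Fin m → Ω → ℝ) (δ : ℝ) :
    m * (δ ^ 2 / 4) ≤ ∑ j, (∑ ω, Q ω * ∑ k, τ k ω ^ 2 +
      ∑ ω, Q ω * L j ω * (τ j ω - δ) ^ 2) := by
  have hm' : (0 : ℝ) < m := by exact_mod_cast hm
  have h1 : ∀ j, δ ^ 2 / 4 ≤ ∑ ω, Q ω * (m * τ j ω ^ 2 + L j ω * (τ j ω - δ) ^ 2) := fun j => by
    have h2 : ∀ ω, δ ^ 2 / 16 * (7 * (Q ω * L j ω) - (m : ℝ)⁻¹ * (Q ω * L j ω ^ 2)) ≤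
        Q ω * (m * τ j ω ^ 2 + L j ω * (τ j ω - δ) ^ 2) := fun ω => by
      -- Apply with w = L/m. Its first moment is 1/m and its second at most 3/m, leaving (7 - 3)/16
      -- = 1/4 after multiplication by m.
      have h3 := sq_add_mul_sub_sq_ge (div_nonneg (hL j ω) hm'.le) (τ j ω) δ
      have h4 := mul_le_mul_of_nonneg_left h3 (mul_nonneg (hQ ω) hm'.le)
      refine (le_of_eq ?_).trans (h4.trans_eq ?_)
      · field_simp
      · field_simp
        ring
    refine le_trans ?_ (Finset.sum_le_sum fun ω _ => h2 ω)
    rw [← Finset.mul_sum, Finset.sum_sub_distrib, ← Finset.mul_sum, ← Finset.mul_sum, hL1]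
    have h5 : (m : ℝ)⁻¹ * ∑ ω, Q ω * L j ω ^ 2 ≤ 3 := by
      rw [inv_mul_le_iff₀ hm']
      linarith [hL2 j]
    nlinarith [sq_nonneg δ]
  have h6 : ∑ j, (∑ ω, Q ω * ∑ k, τ k ω ^ 2 + ∑ ω, Q ω * L j ω * (τ j ω - δ) ^ 2) =
      ∑ j, ∑ ω, Q ω * (m * τ j ω ^ 2 + L j ω * (τ j ω - δ) ^ 2) := by
    have h7 : ∑ _j : Fin m, ∑ ω, Q ω * ∑ k, τ k ω ^ 2 = ∑ j, ∑ ω, Q ω * (m * τ j ω ^ 2) := by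
      rw [Finset.sum_const, Finset.card_univ, Fintype.card_fin, nsmul_eq_mul, Finset.sum_comm,
        Finset.mul_sum]
      refine Finset.sum_congr rfl fun ω _ => ?_
      rw [← Finset.mul_sum, ← Finset.mul_sum]
      ring
    rw [Finset.sum_add_distrib, h7, ← Finset.sum_add_distrib]
    refine Finset.sum_congr rfl fun j _ => ?_
    rw [← Finset.sum_add_distrib]
    exact Finset.sum_congr rfl fun ω _ => by ring
  rw [h6]
  refine le_trans ?_ (Finset.sum_le_sum fun j _ => h1 j)
  simp

/-- Resampling one coordinate of a uniform configuration leaves it uniform; this is how one block is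
treated conditionally on the others. -/
theorem sum_sum_update {ι B : Type*} [Fintype ι] [DecidableEq ι] [Fintype B]
    (F : (ι → B) → ℝ) (b : ι) :
    ∑ c : ι → B, ∑ v, F (Function.update c b v) = Fintype.card B * ∑ c, F c := by
  classical
  rw [← Equiv.sum_comp (Equiv.funSplitAt b B).symm, ← Equiv.sum_comp (Equiv.funSplitAt b B).symm F,
    Fintype.sum_prod_type, Fintype.sum_prod_type]
  have h : ∀ (x v : B) (y : {j // j ≠ b} → B),
      Function.update ((Equiv.funSplitAt b B).symm (x, y)) b v =
        (Equiv.funSplitAt b B).symm (v, y) := fun x v y => by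
    ext i
    by_cases hi : i = b
    · subst hi
      simp
    · simp [hi]
  simp only [h]
  rw [Finset.sum_const, Finset.card_univ, nsmul_eq_mul, Finset.sum_comm]

end BayesBlock

/-! ### The minimax lower bound without stability constraints -/

section SparseLowerBound

variable {n d s m : ℕ}

/-- The mean vector with the value `v` at the coordinate `e (b, j)` for every block `b` whose
configuration is `(true, j)`, and the value `0` elsewhere. -/
def configMean (e : Fin s × Fin m → Fin d) (v : ℝ) (c : Fin s → Bool × Fin m) (k : Fin d) : ℝ :=
  if ∃ b, (c b).1 = true ∧ e (b, (c b).2) = k then v else 0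

variable {e : Fin s × Fin m → Fin d} {v : ℝ}

theorem configMean_update_false (he : Function.Injective e) (c : Fin s → Bool × Fin m) (b : Fin s)
    (j k : Fin m) : configMean e v (Function.update c b (false, j)) (e (b, k)) = 0 := by
  refine if_neg ?_
  rintro ⟨b', h1, h2⟩
  have h3 : b' = b := congrArg Prod.fst (he h2)
  subst h3
  simp at h1

theorem configMean_update_false_eq (c : Fin s → Bool × Fin m) (b : Fin s) (j j' : Fin m) :
    configMean e v (Function.update c b (false, j)) =
      configMean e v (Function.update c b (false, j')) := by
  funext k
  unfold configMean
  refine if_congr (exists_congr fun b' => ?_) rfl rfl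
  rcases eq_or_ne b' b with rfl | hb
  · simp
  · simp [hb]

theorem configMean_update_true (c : Fin s → Bool × Fin m) (b : Fin s) (j j' : Fin m) :
    configMean e v (Function.update c b (true, j)) =
      Function.update (configMean e v (Function.update c b (false, j'))) (e (b, j)) v := by
  funext k
  rcases eq_or_ne k (e (b, j)) with rfl | hk
  · rw [Function.update_self]
    exact if_pos ⟨b, by simp⟩
  · rw [Function.update_of_ne hk]
    unfold configMean
    refine if_congr (exists_congr fun b' => ?_) rfl rfl
    rcases eq_or_ne b' b with rfl | hb
    · simp [hk.symm]
    · simp [hb]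

theorem abs_configMean_le (hv : 0 ≤ v) (hv1 : v ≤ 1) (c : Fin s → Bool × Fin m) (k : Fin d) :
    |configMean e v c k| ≤ 1 := by
  unfold configMean
  split_ifs
  · rwa [abs_of_nonneg hv]
  · simp

theorem card_configMean_ne_zero_le (c : Fin s → Bool × Fin m) :
    (Finset.univ.filter fun k => configMean e v c k ≠ 0).card ≤ s := by
  have hsub : (Finset.univ.filter fun k => configMean e v c k ≠ 0) ⊆
      Finset.univ.image fun b => e (b, (c b).2) := by
    intro k hk
    rw [Finset.mem_filter, configMean] at hk
    by_contra hcon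
    refine hk.2 (if_neg ?_)
    rintro ⟨b, -, hb⟩
    exact hcon (Finset.mem_image.2 ⟨b, Finset.mem_univ b, hb⟩)
  simpa using (Finset.card_le_card hsub).trans Finset.card_image_le

/-- Freeze all blocks but b. The m null configurations of block b share one mean vector, so null and
alternatives have equal total mass and match the two terms of `bayes_risk_block`; dividing by the 2m
configurations turns m(rv)²/4 into (rv)²/8. -/
theorem sum_config_block_ge (he : Function.Injective e) (hm : 1 ≤ m) (hv : 0 ≤ v) (hv1 : v ≤ 1)
    (hvm : (1 + v ^ 2) ^ n ≤ 3 * m) (r : ℝ) (τ : (Fin n → Fin d → Bool) → Fin d → ℝ) (b : Fin s) :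
    Fintype.card (Fin s → Bool × Fin m) * ((r * v) ^ 2 / 8) ≤
      ∑ c, ∑ D : Fin n → Fin d → Bool, (∏ i, signWeight (configMean e v c) (D i)) *
        ∑ j, (τ D (e (b, j)) - r * configMean e v c (e (b, j))) ^ 2 := by
  have hm' : (0 : ℝ) < m := by exact_mod_cast hm
  set F : (Fin s → Bool × Fin m) → ℝ := fun c =>
    ∑ D : Fin n → Fin d → Bool, (∏ i, signWeight (configMean e v c) (D i)) *
        ∑ j, (τ D (e (b, j)) - r * configMean e v c (e (b, j))) ^ 2 with hF
  have key : ∀ c, m * ((r * v) ^ 2 / 4) ≤ ∑ a, F (Function.update c b a) := fun c => by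
    set u := configMean e v (Function.update c b (false, ⟨0, hm⟩)) with hu
    have hu0 : ∀ j, u (e (b, j)) = 0 := fun j => configMean_update_false he c b _ j
    have hu1 : ∀ k, |u k| ≤ 1 := fun k => abs_configMean_le hv hv1 _ k
    have hQ : ∀ D : Fin n → Fin d → Bool, 0 ≤ ∏ i, signWeight u (D i) := fun D =>
      Finset.prod_nonneg fun i _ => signWeight_nonneg hu1 _
    have hL : ∀ (j : Fin m) (D : Fin n → Fin d → Bool), 0 ≤ likelihoodRatio v (e (b, j)) D :=
      fun j D => Finset.prod_nonneg fun i _ =>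
        one_add_mul_boolSign_nonneg (by rwa [abs_of_nonneg hv]) _
    refine (bayes_risk_block hm hQ hL (fun j => sum_mul_likelihoodRatio (hu0 j) v)
      (fun j => (sum_mul_likelihoodRatio_sq (hu0 j) v).trans_le hvm)
      (fun j D => τ D (e (b, j))) (r * v)).trans ?_
    rw [Fintype.sum_prod_type, Fintype.sum_bool, add_comm, ← Finset.sum_add_distrib]
    refine Finset.sum_le_sum fun j _ => add_le_add (le_of_eq ?_) ?_
    · simp only [hF, configMean_update_false_eq c b j ⟨0, hm⟩, ← hu, hu0, mul_zero, sub_zero]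
    · simp only [hF, configMean_update_true c b j ⟨0, hm⟩, ← hu, prod_signWeight_update (hu0 j)]
      -- Under alternative j only the error at coordinate j of the block is kept.
      refine Finset.sum_le_sum fun D _ => mul_le_mul_of_nonneg_left ?_
        (mul_nonneg (hQ D) (hL j D))
      refine le_trans (le_of_eq ?_) (Finset.single_le_sum (fun k _ => sq_nonneg _)
        (Finset.mem_univ j))
      rw [Function.update_self]
  have h1 := Finset.sum_le_sum fun c (_ : c ∈ Finset.univ) => key c
  rw [sum_sum_update F b, Finset.sum_const, Finset.card_univ, nsmul_eq_mul] at h1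
  have h2 : (Fintype.card (Bool × Fin m) : ℝ) = 2 * m := by simp
  rw [h2] at h1
  refine le_of_mul_le_mul_left ?_ hm'
  linarith

theorem sum_config_ge (he : Function.Injective e) (hm : 1 ≤ m) (hv : 0 ≤ v) (hv1 : v ≤ 1)
    (hvm : (1 + v ^ 2) ^ n ≤ 3 * m) (r : ℝ) (τ : (Fin n → Fin d → Bool) → Fin d → ℝ) :
    Fintype.card (Fin s → Bool × Fin m) * (s * ((r * v) ^ 2 / 8)) ≤
      ∑ c, ∑ D : Fin n → Fin d → Bool, (∏ i, signWeight (configMean e v c) (D i)) *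
        ∑ k, (τ D k - r * configMean e v c k) ^ 2 := by
  have h1 := Finset.sum_le_sum fun b (_ : b ∈ (Finset.univ : Finset (Fin s))) =>
    sum_config_block_ge he hm hv hv1 hvm r τ b
  rw [Finset.sum_const, Finset.card_univ, Fintype.card_fin, nsmul_eq_mul] at h1
  refine le_trans (le_of_eq (by ring)) (h1.trans ?_)
  rw [Finset.sum_comm]
  refine Finset.sum_le_sum fun c _ => ?_
  rw [Finset.sum_comm]
  refine Finset.sum_le_sum fun D _ => ?_
  rw [← Finset.mul_sum, ← Fintype.sum_prod_type
    (f := fun p => (τ D (e p) - r * configMean e v c (e p)) ^ 2)]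
  refine mul_le_mul_of_nonneg_left ?_
    (Finset.prod_nonneg fun i _ => signWeight_nonneg (abs_configMean_le hv hv1 c) _)
  rw [← Finset.sum_image (f := fun k => (τ D k - r * configMean e v c k) ^ 2) he.injOn]
  exact Finset.sum_le_sum_of_subset_of_nonneg (Finset.subset_univ _) fun _ _ _ => sq_nonneg _

/-- The point of the `ℓ_∞` ball with the coordinates `± r`. -/
def signPoint {r : ℝ} (hr : 0 ≤ r) (ε : Fin d → Bool) : SupBall d r :=
  ⟨WithLp.toLp 2 fun k => r * boolSign (ε k), fun k => by
    simp [abs_mul, abs_boolSign, abs_of_nonneg hr]⟩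

theorem mean_signPoint {r : ℝ} (hr : 0 ≤ r) {u : Fin d → ℝ} (hu : ∀ k, |u k| ≤ 1) (k : Fin d) :
    mean (finiteLaw (signWeight u) (signWeight_nonneg hu) (sum_signWeight u) (signPoint hr)) k =
      r * u k := by
  rw [mean_finiteLaw_apply, ← sum_signWeight_mul u k, Finset.mul_sum]
  refine Finset.sum_congr rfl fun ε _ => ?_
  simp only [signPoint]
  ring

theorem enorm_sq_eq_ofReal {d : ℕ} (x : EuclideanSpace ℝ (Fin d)) :
    ‖x‖ₑ ^ 2 = ENNReal.ofReal (∑ k, x k ^ 2) := by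
  rw [← ofReal_norm, ← ENNReal.ofReal_pow (norm_nonneg _), EuclideanSpace.norm_sq_eq]
  simp only [Real.norm_eq_abs, sq_abs]

/-- The supremum dominates the average over configurations, and `sum_config_ge` applies for each
fixed seed, so randomization does not help. -/
theorem supRisk_ge_of_config {r : ℝ} (hr : 0 < r) (he : Function.Injective e) (hm : 1 ≤ m)
    (hv : 0 ≤ v) (hv1 : v ≤ 1) (hvm : (1 + v ^ 2) ^ n ≤ 3 * m)
    {T : Estimator (SupBall d r) n d} (hT : Measurable T) :
    ENNReal.ofReal (s * ((r * v) ^ 2 / 8)) ≤ supRisk (sparseClass d r s) mean T := by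
  have hu := fun c => abs_configMean_le (e := e) (v := v) hv hv1 c
  let P : (Fin s → Bool × Fin m) → ProbabilityMeasure (SupBall d r) := fun c =>
    finiteLaw (signWeight (configMean e v c)) (signWeight_nonneg (hu c)) (sum_signWeight _)
      (signPoint hr.le)
  have hmean : ∀ c k, mean (P c) k = r * configMean e v c k := fun c k =>
    mean_signPoint hr.le (hu c) k
  have hP : ∀ c, P c ∈ sparseClass d r s := fun c => by
    refine (Finset.card_le_card fun k => ?_).trans (card_configMean_ne_zero_le (e := e) (v := v) c)
    rw [Finset.mem_filter, Finset.mem_filter, hmean]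
    exact fun h => ⟨h.1, right_ne_zero_of_mul h.2⟩
  have hmeas : ∀ c (D : Fin n → Fin d → Bool), Measurable fun ξ : I =>
      ‖T (fun i => signPoint hr.le (D i), ξ) - mean (P c)‖ₑ ^ 2 := fun c D =>
    ((hT.comp measurable_prodMk_left).sub_const _).enorm.pow_const 2
  have hsum : ENNReal.ofReal (Fintype.card (Fin s → Bool × Fin m) * (s * ((r * v) ^ 2 / 8))) ≤
      ∑ c, risk T (P c) (mean (P c)) := by
    calc _ = ∫⁻ _ : I, ENNReal.ofReal
            (Fintype.card (Fin s → Bool × Fin m) * (s * ((r * v) ^ 2 / 8))) := by simp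
      _ ≤ ∫⁻ ξ : I, ∑ c, ∑ D : Fin n → Fin d → Bool,
            ENNReal.ofReal (∏ i, signWeight (configMean e v c) (D i)) *
              ‖T (fun i => signPoint hr.le (D i), ξ) - mean (P c)‖ₑ ^ 2 := by
          refine lintegral_mono fun ξ => ?_
          refine (ENNReal.ofReal_le_ofReal (sum_config_ge he hm hv hv1 hvm r
            fun D k => T (fun i => signPoint hr.le (D i), ξ) k)).trans_eq ?_
          have hw : ∀ c (D : Fin n → Fin d → Bool),
              0 ≤ ∏ i, signWeight (configMean e v c) (D i) := fun c D =>
            Finset.prod_nonneg fun i _ => signWeight_nonneg (hu c) _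
          have hs : ∀ c (D : Fin n → Fin d → Bool),
              0 ≤ ∑ k, (T (fun i => signPoint hr.le (D i), ξ) k - r * configMean e v c k) ^ 2 :=
            fun c D => Finset.sum_nonneg fun _ _ => sq_nonneg _
          rw [ENNReal.ofReal_sum_of_nonneg fun c _ => Finset.sum_nonneg fun D _ =>
            mul_nonneg (hw c D) (hs c D)]
          refine Finset.sum_congr rfl fun c _ => ?_
          rw [ENNReal.ofReal_sum_of_nonneg fun D _ => mul_nonneg (hw c D) (hs c D)]
          refine Finset.sum_congr rfl fun D _ => ?_
          rw [ENNReal.ofReal_mul (hw c D), enorm_sq_eq_ofReal]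
          simp only [PiLp.sub_apply, hmean]
      _ = ∑ c, risk T (P c) (mean (P c)) := by
          rw [lintegral_finsetSum _ fun c _ => Finset.measurable_sum _ fun D _ =>
            (hmeas c D).const_mul _]
          refine Finset.sum_congr rfl fun c _ => ?_
          rw [lintegral_finsetSum _ fun D _ => (hmeas c D).const_mul _, risk_finiteLaw _ _ _ hT]
          exact Finset.sum_congr rfl fun D _ => lintegral_const_mul _ (hmeas c D)
  have hle : ∑ c, risk T (P c) (mean (P c)) ≤
      (Fintype.card (Fin s → Bool × Fin m) : ℝ≥0∞) * supRisk (sparseClass d r s) mean T := by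
    refine (Finset.sum_le_sum fun c _ => le_iSup₂ (f := fun P _ => risk T P (mean P))
      (P c) (hP c)).trans_eq ?_
    rw [Finset.sum_const, Finset.card_univ, nsmul_eq_mul]
    rfl
  have hcard : Fintype.card (Fin s → Bool × Fin m) ≠ 0 := by
    have : Nonempty (Fin m) := ⟨⟨0, hm⟩⟩
    exact Fintype.card_ne_zero
  rw [ENNReal.ofReal_mul (Nat.cast_nonneg _), ENNReal.ofReal_natCast] at hsum
  exact (ENNReal.mul_le_mul_iff_right (by exact_mod_cast hcard) (ENNReal.natCast_ne_top _)).1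
    (hsum.trans hle)

theorem supRisk_ge_of_log_le {r K : ℝ} (hd : 2 ≤ d) (hn : 1 ≤ n) (hs : 1 ≤ s) (hsd : s ≤ d)
    (hr : 0 < r) (hK : 0 < K) (h1 : Real.log d ≤ K * Real.log (Real.exp 1 * d / s))
    (h2 : Real.log d ≤ K * n) {T : Estimator (SupBall d r) n d} (hT : Measurable T) :
    ENNReal.ofReal (1 / (40 * K) * (r ^ 2 * s * Real.log d / n)) ≤
      supRisk (sparseClass d r s) mean T := by
  have hn' : (0 : ℝ) < n := by exact_mod_cast hn
  have hs' : (0 : ℝ) < s := by exact_mod_cast hs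
  have hd' : (0 : ℝ) < d := by exact_mod_cast (by omega : 0 < d)
  set m := d / s with hm_def
  have hm : 1 ≤ m := (Nat.one_le_div_iff hs).2 hsd
  have hm' : (1 : ℝ) ≤ m := by exact_mod_cast hm
  have hdm : (d : ℝ) ≤ 2 * (s * m) := by
    have h3 : d < s * m + s := by
      have := Nat.lt_div_mul_add (a := d) hs
      rwa [mul_comm] at this
    have h4 : s ≤ s * m := Nat.le_mul_of_pos_right _ hm
    exact_mod_cast (by omega : d ≤ 2 * (s * m))
  have hsm : s * m ≤ d := Nat.mul_div_le d s
  have he : Function.Injective (fun p : Fin s × Fin m => Fin.castLE hsm (finProdFinEquiv p)) :=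
    (Fin.castLE_injective hsm).comp finProdFinEquiv.injective
  set M := Real.log (Real.exp 1 * m) with hM
  have hM1 : M = 1 + Real.log m := by
    rw [hM, Real.log_mul (Real.exp_pos 1).ne' (by linarith), Real.log_exp]
  have hMpos : 1 ≤ M := by linarith [Real.log_nonneg hm']
  have hlog : Real.log (Real.exp 1 * d / s) ≤ M + Real.log 2 := by
    rw [hM, ← Real.log_mul (by positivity) (by norm_num)]
    refine Real.log_le_log (by positivity) ?_
    rw [div_le_iff₀ hs']
    nlinarith [Real.exp_pos 1]
  have hlogM : Real.log d ≤ 2 * K * M := by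
    have : M + Real.log 2 ≤ 2 * M := by linarith [Real.log_two_lt_d9]
    nlinarith
  -- Then (1 + v²)^n ≤ exp M = em ≤ 3m, while v ≤ 1 keeps the weights nonnegative.
  set v := √(min 1 (M / n)) with hv
  have hmin : 0 ≤ min 1 (M / n) := by positivity
  have hvsq : v ^ 2 = min 1 (M / n) := Real.sq_sqrt hmin
  have hv1 : v ≤ 1 := Real.sqrt_le_one.2 (min_le_left _ _)
  have hvm : (1 + v ^ 2) ^ n ≤ 3 * m := by
    have h3 : v ^ 2 ≤ M / n := hvsq.trans_le (min_le_right _ _)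
    calc (1 + v ^ 2) ^ n ≤ Real.exp (M / n) ^ n := by
          gcongr
          linarith [Real.add_one_le_exp (M / n)]
      _ = Real.exp 1 * m := by
          rw [← Real.exp_nat_mul, mul_div_cancel₀ _ hn'.ne', hM, Real.exp_log (by positivity)]
      _ ≤ 3 * m := by
          gcongr
          linarith [Real.exp_one_lt_d9]
  refine le_trans (ENNReal.ofReal_le_ofReal ?_)
    (supRisk_ge_of_config hr he hm (Real.sqrt_nonneg _) hv1 hvm hT)
  rw [mul_pow, hvsq]
  -- The two branches use log d ≤ Kn and log d ≤ 2KM respectively.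
  have h5 : Real.log d / (2 * K * n) ≤ min 1 (M / n) := by
    refine le_min ?_ ?_
    · rw [div_le_one (by positivity)]
      nlinarith
    · rw [div_le_div_iff₀ (by positivity) hn']
      nlinarith
  have hlog0 : 0 ≤ Real.log d := Real.log_natCast_nonneg d
  calc _ = (16 / 40) * (s * (r ^ 2 * (Real.log d / (2 * K * n)) / 8)) := by
        field_simp
        ring
    _ ≤ 1 * (s * (r ^ 2 * (Real.log d / (2 * K * n)) / 8)) := by
        gcongr
        norm_num
    _ ≤ _ := by
        rw [one_mul]
        gcongr

end SparseLowerBound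

/-! ### The minimax lower bound under a small stability budget -/

section Stability

variable {𝒳 : Type*} [MeasurableSpace 𝒳] {n d : ℕ}

/-- Monotonicity of L^p norms on the probability space of seeds. -/
theorem seedDist_one_rpow_le {T : Estimator 𝒳 n d} (hT : Measurable T) {p : ℝ≥0∞} (hp : 1 ≤ p)
    (hpt : p ≠ ∞) (D D' : Fin n → 𝒳) :
    seedDist T 1 D D' ^ p.toReal ≤ seedDist T p.toReal D D' := by
  have hm : AEStronglyMeasurable (fun ξ : I => T (D, ξ) - T (D', ξ)) volume :=
    ((hT.comp measurable_prodMk_left).sub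
      (hT.comp measurable_prodMk_left)).aestronglyMeasurable
  have h := eLpNorm_le_eLpNorm_of_exponent_le hp hm
  have hp0 : 0 < p.toReal := ENNReal.toReal_pos (by positivity) hpt
  rw [eLpNorm_one_eq_lintegral_enorm,
    eLpNorm_eq_lintegral_rpow_enorm_toReal (by positivity) hpt] at h
  have h2 := ENNReal.rpow_le_rpow h hp0.le
  rw [one_div, ENNReal.rpow_inv_rpow hp0.ne'] at h2
  simpa only [seedDist, ENNReal.rpow_one] using h2

/-- `ℓ_p`-stability implies `ℓ_1`-stability. -/
theorem IsLpStable.sum_seedDist_one_le {T : Estimator 𝒳 n d} {p : ℝ≥0∞} {β : ℝ}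
    (h : IsLpStable T p β) (hT : Measurable T) (hp : 1 ≤ p) (D : Fin (n + 1) → 𝒳) :
    ∑ i : Fin (n + 1), ∑ j : Fin (n + 1), seedDist T 1 (i.removeNth D) (j.removeNth D) ≤
      ((n : ℝ≥0∞) + 1) ^ 2 * ENNReal.ofReal β := by
  unfold IsLpStable at h
  split_ifs at h with hpt
  · simp only [iSup_le_iff] at h
    refine (Finset.sum_le_sum fun i _ => Finset.sum_le_sum fun j _ => h D i j).trans_eq ?_
    simp only [Finset.sum_const, Finset.card_univ, Fintype.card_fin, nsmul_eq_mul]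
    push_cast
    ring
  · have hp0 : 0 < p.toReal := ENNReal.toReal_pos (by positivity) hpt
    have hp1 : 1 ≤ p.toReal := by
      rw [← ENNReal.toReal_one]
      exact ENNReal.toReal_mono hpt hp
    set N : ℝ≥0∞ := ((n : ℝ≥0∞) + 1) ^ 2 with hN
    have hN0 : N ≠ 0 := by positivity
    have hNt : N ≠ ∞ := by finiteness
    have hw : ∑ _p : Fin (n + 1) × Fin (n + 1), N⁻¹ = 1 := by
      simp only [Finset.sum_const, Finset.card_univ, Fintype.card_prod, Fintype.card_fin,
        nsmul_eq_mul]
      push_cast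
      rw [← sq, ← hN, ENNReal.mul_inv_cancel hN0 hNt]
    -- The power mean inequality over uniformly weighted pairs (i, j), complementing the one over
    -- seeds.
    have h1 := ENNReal.rpow_arith_mean_le_arith_mean_rpow Finset.univ
      (fun _ : Fin (n + 1) × Fin (n + 1) => N⁻¹)
      (fun q => seedDist T 1 (q.1.removeNth D) (q.2.removeNth D)) hw hp1
    rw [← Finset.mul_sum, ← Finset.mul_sum, Fintype.sum_prod_type, Fintype.sum_prod_type] at h1
    have h2 : N⁻¹ * ∑ i : Fin (n + 1), ∑ j : Fin (n + 1),
        seedDist T 1 (i.removeNth D) (j.removeNth D) ^ p.toReal ≤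
        N⁻¹ * ⨆ D : Fin (n + 1) → 𝒳, ∑ i : Fin (n + 1), ∑ j : Fin (n + 1),
          seedDist T p.toReal (i.removeNth D) (j.removeNth D) := by
      gcongr
      refine le_iSup_of_le D ?_
      gcongr
      exact seedDist_one_rpow_le hT hp hpt _ _
    have h3 := (ENNReal.rpow_le_rpow (h1.trans h2) (by positivity : 0 ≤ 1 / p.toReal)).trans h
    rw [one_div, ENNReal.rpow_rpow_inv hp0.ne'] at h3
    rwa [mul_comm, ← div_eq_mul_inv, ENNReal.div_le_iff hN0 hNt, mul_comm] at h3

end Stability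

/-! ### Stability and the derivative of Bernoulli expectations -/

section BinomialDerivative

variable {n : ℕ}

/-- The Bernoulli weights. -/
def bernWeight (q : ℝ) (b : Bool) : ℝ := if b then q else 1 - q

/-- The indicator of `true`. -/
def boolInd (b : Bool) : ℝ := if b then 1 else 0

theorem bernWeight_nonneg {q : ℝ} (h0 : 0 ≤ q) (h1 : q ≤ 1) (b : Bool) : 0 ≤ bernWeight q b := by
  cases b <;> simp [bernWeight, h0, h1]

theorem bernWeight_pos {q : ℝ} (h0 : 0 < q) (h1 : q < 1) (b : Bool) : 0 < bernWeight q b := by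
  cases b <;> simp [bernWeight, h0, h1]

theorem sum_bernWeight (q : ℝ) : ∑ b, bernWeight q b = 1 := by
  simp [bernWeight]

theorem sum_prod_bernWeight (q : ℝ) : ∑ Z : Fin n → Bool, ∏ i, bernWeight q (Z i) = 1 := by
  rw [← Fintype.sum_pow, sum_bernWeight, one_pow]

theorem hasDerivAt_bernWeight {q : ℝ} (h0 : 0 < q) (h1 : q < 1) (b : Bool) :
    HasDerivAt (fun q => bernWeight q b) (bernWeight q b * ((boolInd b - q) / (q * (1 - q)))) q := by
  have hq : 1 - q ≠ 0 := by linarith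
  cases b
  · simp only [bernWeight, boolInd, Bool.false_eq_true, if_false]
    refine ((hasDerivAt_id q).const_sub 1).congr_deriv ?_
    field_simp
    ring
  · simp only [bernWeight, boolInd, if_true]
    refine (hasDerivAt_id q).congr_deriv ?_
    field_simp

theorem hasDerivAt_prod_bernWeight {q : ℝ} (h0 : 0 < q) (h1 : q < 1) (Z : Fin n → Bool) :
    HasDerivAt (fun q => ∏ i, bernWeight q (Z i))
      ((∏ i, bernWeight q (Z i)) * ((∑ i, (boolInd (Z i) - q)) / (q * (1 - q)))) q := by
  have h := HasDerivAt.fun_finsetProd (u := Finset.univ)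
    fun i _ => hasDerivAt_bernWeight h0 h1 (Z i)
  refine h.congr_deriv ?_
  rw [Finset.sum_div, Finset.mul_sum]
  refine Finset.sum_congr rfl fun i _ => ?_
  rw [← Finset.mul_prod_erase _ _ (Finset.mem_univ i), smul_eq_mul]
  ring

/-- The deleted point is independent of the rest and has mean q, so integrating it out replaces
`boolInd (D j)` by q; the term i = j vanishes. -/
theorem sum_prod_bernWeight_removeNth (q : ℝ) (t : (Fin n → Bool) → ℝ) (j : Fin (n + 1)) :
    ∑ D : Fin (n + 1) → Bool, (∏ i, bernWeight q (D i)) *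
        (t (j.removeNth D) * ∑ i, (boolInd (D i) - boolInd (D j))) =
      ∑ Z : Fin n → Bool, (∏ i, bernWeight q (Z i)) * (t Z * ∑ i, (boolInd (Z i) - q)) := by
  rw [← Equiv.sum_comp (Fin.insertNthEquiv (fun _ => Bool) j), Fintype.sum_prod_type,
    Finset.sum_comm]
  refine Finset.sum_congr rfl fun Z _ => ?_
  have hrem : ∀ b, j.removeNth (Fin.insertNthEquiv (fun _ => Bool) j (b, Z)) = Z := fun b => by
    simp [Fin.insertNthEquiv]
  simp only [hrem, Fin.insertNthEquiv_apply, Fin.prod_univ_succAbove _ j,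
    Fin.sum_univ_succAbove _ j, Fin.insertNth_apply_same, Fin.insertNth_apply_succAbove,
    Fintype.sum_bool, bernWeight, boolInd, if_true, Bool.false_eq_true, if_false,
    Finset.sum_sub_distrib, Finset.sum_const, Finset.card_univ, Fintype.card_fin, nsmul_eq_mul]
  ring

theorem sum_prod_bernWeight_score_le {q G : ℝ} (h0 : 0 ≤ q) (h1 : q ≤ 1) {t : (Fin n → Bool) → ℝ}
    (hG : ∀ D : Fin (n + 1) → Bool, ∑ i : Fin (n + 1), ∑ j : Fin (n + 1),
      |t (i.removeNth D) - t (j.removeNth D)| ≤ G) :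
    2 * (n + 1) * ∑ Z : Fin n → Bool, (∏ i, bernWeight q (Z i)) *
      (t Z * ∑ i, (boolInd (Z i) - q)) ≤ G := by
  have hpt : ∀ D : Fin (n + 1) → Bool,
      2 * ∑ j : Fin (n + 1), t (j.removeNth D) * ∑ i, (boolInd (D i) - boolInd (D j)) ≤ G := by
    intro D
    refine le_trans ?_ (hG D)
    -- Antisymmetry in (i, j) turns values of t into differences, the only quantity that stability
    -- controls.
    have hsym : ∑ i : Fin (n + 1), ∑ j : Fin (n + 1),
        (boolInd (D i) - boolInd (D j)) * (t (j.removeNth D) - t (i.removeNth D)) =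
        2 * ∑ j : Fin (n + 1), t (j.removeNth D) * ∑ i, (boolInd (D i) - boolInd (D j)) := by
      have e1 : ∑ i : Fin (n + 1), ∑ j : Fin (n + 1),
          (boolInd (D i) - boolInd (D j)) * t (j.removeNth D) =
          ∑ j : Fin (n + 1), t (j.removeNth D) * ∑ i, (boolInd (D i) - boolInd (D j)) := by
        rw [Finset.sum_comm]
        refine Finset.sum_congr rfl fun j _ => ?_
        rw [Finset.mul_sum]
        exact Finset.sum_congr rfl fun i _ => mul_comm _ _
      have e2 : ∑ i : Fin (n + 1), ∑ j : Fin (n + 1),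
          (boolInd (D i) - boolInd (D j)) * t (i.removeNth D) =
          -∑ j : Fin (n + 1), t (j.removeNth D) * ∑ i, (boolInd (D i) - boolInd (D j)) := by
        rw [← Finset.sum_neg_distrib]
        refine Finset.sum_congr rfl fun j _ => ?_
        rw [Finset.mul_sum, ← Finset.sum_neg_distrib]
        exact Finset.sum_congr rfl fun i _ => by ring
      have e3 : ∑ i : Fin (n + 1), ∑ j : Fin (n + 1),
          (boolInd (D i) - boolInd (D j)) * (t (j.removeNth D) - t (i.removeNth D)) =
          ∑ i : Fin (n + 1), ∑ j : Fin (n + 1),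
            (boolInd (D i) - boolInd (D j)) * t (j.removeNth D) -
          ∑ i : Fin (n + 1), ∑ j : Fin (n + 1),
            (boolInd (D i) - boolInd (D j)) * t (i.removeNth D) := by
        rw [← Finset.sum_sub_distrib]
        refine Finset.sum_congr rfl fun i _ => ?_
        rw [← Finset.sum_sub_distrib]
        exact Finset.sum_congr rfl fun j _ => mul_sub _ _ _
      rw [e3, e1, e2]
      ring
    rw [← hsym]
    refine Finset.sum_le_sum fun i _ => Finset.sum_le_sum fun j _ => ?_
    refine (le_abs_self _).trans ?_
    rw [abs_mul, abs_sub_comm (t _)]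
    have : |boolInd (D i) - boolInd (D j)| ≤ 1 := by
      cases D i <;> cases D j <;> simp [boolInd]
    exact mul_le_of_le_one_left (abs_nonneg _) this
  have hsum : ∑ D : Fin (n + 1) → Bool, (∏ i, bernWeight q (D i)) *
      (2 * ∑ j : Fin (n + 1), t (j.removeNth D) * ∑ i, (boolInd (D i) - boolInd (D j))) ≤ G := by
    refine (Finset.sum_le_sum fun D _ => mul_le_mul_of_nonneg_left (hpt D)
      (Finset.prod_nonneg fun i _ => bernWeight_nonneg h0 h1 _)).trans_eq ?_
    rw [← Finset.sum_mul, sum_prod_bernWeight, one_mul]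
  refine le_trans (le_of_eq ?_) hsum
  have h2 : ∀ D : Fin (n + 1) → Bool, (∏ i, bernWeight q (D i)) *
      (2 * ∑ j : Fin (n + 1), t (j.removeNth D) * ∑ i, (boolInd (D i) - boolInd (D j))) =
      2 * ∑ j : Fin (n + 1), (∏ i, bernWeight q (D i)) *
        (t (j.removeNth D) * ∑ i, (boolInd (D i) - boolInd (D j))) := fun D => by
    rw [← Finset.mul_sum]
    ring
  simp only [h2]
  rw [← Finset.mul_sum, Finset.sum_comm]
  simp only [sum_prod_bernWeight_removeNth, Finset.sum_const, Finset.card_univ, Fintype.card_fin,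
    nsmul_eq_mul]
  push_cast
  ring

/-- A function of a binary sample that is stable under deletion of a data point has an
expectation that changes slowly with the success probability. -/
theorem bernoulli_mean_sub_le {G : ℝ} {t : (Fin n → Bool) → ℝ}
    (hG : ∀ D : Fin (n + 1) → Bool, ∑ i : Fin (n + 1), ∑ j : Fin (n + 1),
      |t (i.removeNth D) - t (j.removeNth D)| ≤ G) :
    ∑ Z : Fin n → Bool, (∏ i, bernWeight (3 / 4) (Z i)) * t Z -
      ∑ Z : Fin n → Bool, (∏ i, bernWeight (1 / 4) (Z i)) * t Z ≤ 4 / 3 * (G / (n + 1)) := by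
  have hn : (0 : ℝ) < n + 1 := by positivity
  have hG0 : 0 ≤ G := le_trans (Finset.sum_nonneg fun i _ => Finset.sum_nonneg fun j _ =>
    abs_nonneg _) (hG fun _ => true)
  have hder : ∀ q ∈ Set.Icc (1 / 4 : ℝ) (3 / 4), HasDerivAt
      (fun q => ∑ Z : Fin n → Bool, (∏ i, bernWeight q (Z i)) * t Z)
      (∑ Z : Fin n → Bool, ((∏ i, bernWeight q (Z i)) *
        ((∑ i, (boolInd (Z i) - q)) / (q * (1 - q)))) * t Z) q := fun q hq =>
    HasDerivAt.fun_sum fun Z _ => (hasDerivAt_prod_bernWeight (by linarith [hq.1])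
      (by linarith [hq.2]) Z).mul_const _
  -- The score term is at most G/(2(n + 1)) and q(1 - q) ≥ 3/16, so the slope is at most 8/3 · G/(n
  -- + 1); the interval has length 1/2.
  have h := (convex_Icc (1 / 4 : ℝ) (3 / 4)).image_sub_le_mul_sub_of_deriv_le
    (f := fun q => ∑ Z : Fin n → Bool, (∏ i, bernWeight q (Z i)) * t Z)
    (fun q hq => (hder q hq).continuousAt.continuousWithinAt)
    (fun q hq => (hder q (interior_subset hq)).differentiableAt.differentiableWithinAt)
    (C := 8 / 3 * (G / (n + 1))) (fun q hq => by
      have hq' := interior_subset hq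
      rw [(hder q hq').deriv]
      have hpos : 0 < q * (1 - q) := mul_pos (by linarith [hq'.1]) (by linarith [hq'.2])
      have h3 : 3 / 16 ≤ q * (1 - q) := by
        nlinarith [mul_nonneg (sub_nonneg.2 hq'.1) (sub_nonneg.2 hq'.2)]
      have h4 := sum_prod_bernWeight_score_le (q := q) (by linarith [hq'.1])
        (by linarith [hq'.2]) hG
      have h5 : ∑ Z : Fin n → Bool, ((∏ i, bernWeight q (Z i)) *
          ((∑ i, (boolInd (Z i) - q)) / (q * (1 - q)))) * t Z =
          (∑ Z : Fin n → Bool, (∏ i, bernWeight q (Z i)) *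
            (t Z * ∑ i, (boolInd (Z i) - q))) / (q * (1 - q)) := by
        rw [Finset.sum_div]
        exact Finset.sum_congr rfl fun Z _ => by ring
      rw [h5, div_le_iff₀ hpos]
      have h6 : ∑ Z : Fin n → Bool, (∏ i, bernWeight q (Z i)) *
            (t Z * ∑ i, (boolInd (Z i) - q)) ≤ 1 / 2 * (G / (n + 1)) := by
        rw [← mul_div_assoc, le_div_iff₀ hn]
        linarith
      have h7 : 0 ≤ G / (n + 1) := by positivity
      nlinarith)
    (1 / 4) ⟨le_rfl, by norm_num⟩ (3 / 4) ⟨by norm_num, le_rfl⟩ (by norm_num)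
  linarith

end BinomialDerivative

/-! ### Bias against stability in a two-point submodel -/

section StableLowerBound

open scoped RealInnerProductSpace

variable {n d : ℕ}

/-- All data sets over the support have positive mass, so finite risk bounds the second moment over
the seed for each one; the real integrals below rely on this integrability. -/
theorem memLp_sub_of_risk_lt {𝒳 A : Type*} [MeasurableSpace 𝒳] [Fintype A] [MeasurableSpace A]
    [MeasurableSingletonClass A] {w : A → ℝ} (hw : ∀ a, 0 < w a) (hw1 : ∑ a, w a = 1)
    {x : A → 𝒳} {T : Estimator 𝒳 n d} (hT : Measurable T) {θ : EuclideanSpace ℝ (Fin d)}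
    (h : risk T (finiteLaw w (fun a => (hw a).le) hw1 x) θ < ∞) (Z : Fin n → A) :
    MemLp (fun ξ : I => T (fun i => x (Z i), ξ) - θ) 2 volume := by
  rw [risk_finiteLaw _ _ _ hT, ENNReal.sum_lt_top] at h
  have h1 := ENNReal.lt_top_of_mul_ne_top_right (h Z (Finset.mem_univ Z)).ne
    (ENNReal.ofReal_pos.2 (Finset.prod_pos fun i _ => hw (Z i))).ne'
  refine ⟨((hT.comp measurable_prodMk_left).sub_const θ).aestronglyMeasurable, ?_⟩
  rw [eLpNorm_lt_top_iff_lintegral_rpow_enorm_lt_top two_ne_zero ENNReal.ofNat_ne_top]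
  simpa using h1

/-- The squared bias of a linear functional of an estimator is controlled by the risk. -/
theorem sq_bias_le {𝒳 A : Type*} [MeasurableSpace 𝒳] [Fintype A] [MeasurableSpace A]
    [MeasurableSingletonClass A] {w : A → ℝ} (hw : ∀ a, 0 < w a) (hw1 : ∑ a, w a = 1)
    {x : A → 𝒳} {T : Estimator 𝒳 n d} (hT : Measurable T) {θ : EuclideanSpace ℝ (Fin d)} {κ : ℝ}
    (h : risk T (finiteLaw w (fun a => (hw a).le) hw1 x) θ < ENNReal.ofReal κ)
    (a : EuclideanSpace ℝ (Fin d)) :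
    (∑ Z : Fin n → A, (∏ i, w (Z i)) * (∫ ξ : I, ⟪a, T (fun i => x (Z i), ξ)⟫) - ⟪a, θ⟫) ^ 2 ≤
      ‖a‖ ^ 2 * κ := by
  have hmem := memLp_sub_of_risk_lt hw hw1 hT (h.trans ENNReal.ofReal_lt_top)
  have hW : ∀ Z : Fin n → A, 0 ≤ ∏ i, w (Z i) := fun Z => Finset.prod_nonneg fun i _ => (hw _).le
  have hsq : ∀ Z : Fin n → A, Integrable (fun ξ : I => ‖T (fun i => x (Z i), ξ) - θ‖ ^ 2) volume :=
    fun Z => (hmem Z).norm.integrable_sq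
  have hrisk : ∑ Z : Fin n → A, (∏ i, w (Z i)) * ∫ ξ : I, ‖T (fun i => x (Z i), ξ) - θ‖ ^ 2
      ≤ κ := by
    rw [risk_finiteLaw _ _ _ hT] at h
    refine ((ENNReal.ofReal_lt_ofReal_iff_of_nonneg (Finset.sum_nonneg fun Z _ =>
      mul_nonneg (hW Z) (integral_nonneg fun _ => sq_nonneg _))).1 (lt_of_eq_of_lt ?_ h)).le
    rw [ENNReal.ofReal_sum_of_nonneg fun Z _ =>
      mul_nonneg (hW Z) (integral_nonneg fun _ => sq_nonneg _)]
    refine Finset.sum_congr rfl fun Z _ => ?_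
    rw [ENNReal.ofReal_mul (hW Z), ofReal_integral_eq_lintegral_ofReal (hsq Z)
      (Filter.Eventually.of_forall fun _ => sq_nonneg _)]
    simp only [ENNReal.ofReal_pow (norm_nonneg _), ofReal_norm]
  have hint : ∀ Z : Fin n → A,
      Integrable (fun ξ : I => ⟪a, T (fun i => x (Z i), ξ) - θ⟫) volume := fun Z =>
    ((hmem Z).integrable one_le_two).const_inner a
  set b := ∑ Z : Fin n → A, (∏ i, w (Z i)) * ∫ ξ : I, ⟪a, T (fun i => x (Z i), ξ) - θ⟫ with hb
  have hW1 : ∑ Z : Fin n → A, ∏ i, w (Z i) = 1 := by rw [← Fintype.sum_pow, hw1, one_pow]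
  -- Jensen's inequality in linearized form, 2bz - b² ≤ z². With b the bias, averaging over Z turns
  -- the left side into b².
  have hZ : ∀ Z : Fin n → A, 2 * b * (∫ ξ : I, ⟪a, T (fun i => x (Z i), ξ) - θ⟫) - b ^ 2 ≤
      ‖a‖ ^ 2 * ∫ ξ : I, ‖T (fun i => x (Z i), ξ) - θ‖ ^ 2 := fun Z => by
    have h1 : ∫ ξ : I, (2 * b * ⟪a, T (fun i => x (Z i), ξ) - θ⟫ - b ^ 2) ≤
        ∫ ξ : I, ‖a‖ ^ 2 * ‖T (fun i => x (Z i), ξ) - θ‖ ^ 2 := by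
      refine integral_mono (((hint Z).const_mul _).sub (integrable_const _))
        ((hsq Z).const_mul _) fun ξ => ?_
      have h2 := abs_real_inner_le_norm a (T (fun i => x (Z i), ξ) - θ)
      have h3 := pow_le_pow_left₀ (abs_nonneg _) h2 2
      rw [sq_abs, mul_pow] at h3
      simp only
      nlinarith [sq_nonneg (⟪a, T (fun i => x (Z i), ξ) - θ⟫ - b)]
    rw [integral_sub ((hint Z).const_mul _) (integrable_const _), integral_const_mul,
      integral_const_mul] at h1
    simpa using h1
  have hbb : b ^ 2 ≤ ‖a‖ ^ 2 * κ := by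
    have h1 := Finset.sum_le_sum fun Z (_ : Z ∈ Finset.univ) =>
      mul_le_mul_of_nonneg_left (hZ Z) (hW Z)
    have h2 : ∑ Z : Fin n → A, (∏ i, w (Z i)) *
        (2 * b * (∫ ξ : I, ⟪a, T (fun i => x (Z i), ξ) - θ⟫) - b ^ 2) = b ^ 2 := by
      simp only [mul_sub, Finset.sum_sub_distrib, ← Finset.sum_mul, hW1]
      rw [Finset.sum_congr rfl fun Z _ => mul_left_comm (∏ i, w (Z i)) (2 * b) _,
        ← Finset.mul_sum, ← hb]
      ring
    rw [h2] at h1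
    refine h1.trans ?_
    rw [Finset.sum_congr rfl fun Z _ => mul_left_comm (∏ i, w (Z i)) (‖a‖ ^ 2) _,
      ← Finset.mul_sum]
    gcongr
  refine le_of_eq_of_le (congrArg (· ^ 2) ?_) hbb
  have h4 : ∀ Z : Fin n → A, ∫ ξ : I, ⟪a, T (fun i => x (Z i), ξ)⟫ =
      (∫ ξ : I, ⟪a, T (fun i => x (Z i), ξ) - θ⟫) + ⟪a, θ⟫ := fun Z => by
    have h5 : ∀ ξ : I, ⟪a, T (fun i => x (Z i), ξ)⟫ =
        ⟪a, T (fun i => x (Z i), ξ) - θ⟫ + ⟪a, θ⟫ := fun ξ => by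
      rw [inner_sub_right, sub_add_cancel]
    simp only [h5]
    rw [integral_add (hint Z) (integrable_const _)]
    simp
  simp only [h4, mul_add, Finset.sum_add_distrib, ← Finset.sum_mul, hW1, ← hb]
  ring

/-- Cauchy–Schwarz carries stability of T over to the seed-averaged scalar statistic, at the cost of
‖a‖. -/
theorem sum_abs_integral_inner_sub_le {𝒳 : Type*} [MeasurableSpace 𝒳] {T : Estimator 𝒳 n d}
    (hT : Measurable T) {p : ℝ≥0∞} (hp : 1 ≤ p) {β : ℝ} (hβ : 0 ≤ β) (hst : IsLpStable T p β)
    (a : EuclideanSpace ℝ (Fin d)) (D : Fin (n + 1) → 𝒳)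
    (hint : ∀ i : Fin (n + 1), Integrable (fun ξ : I => T (i.removeNth D, ξ)) volume) :
    ∑ i : Fin (n + 1), ∑ j : Fin (n + 1),
      |(∫ ξ : I, ⟪a, T (i.removeNth D, ξ)⟫) - ∫ ξ : I, ⟪a, T (j.removeNth D, ξ)⟫| ≤
      ‖a‖ * ((n + 1) ^ 2 * β) := by
  have h1 : ∀ i j : Fin (n + 1), ENNReal.ofReal
      |(∫ ξ : I, ⟪a, T (i.removeNth D, ξ)⟫) - ∫ ξ : I, ⟪a, T (j.removeNth D, ξ)⟫| ≤
      ENNReal.ofReal ‖a‖ * seedDist T 1 (i.removeNth D) (j.removeNth D) := fun i j => by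
    rw [← integral_sub ((hint i).const_inner a) ((hint j).const_inner a), ← Real.norm_eq_abs,
      ofReal_norm]
    refine (enorm_integral_le_lintegral_enorm _).trans ?_
    have hm : Measurable fun ξ : I => ‖T (i.removeNth D, ξ) - T (j.removeNth D, ξ)‖ₑ :=
      ((hT.comp measurable_prodMk_left).sub (hT.comp measurable_prodMk_left)).enorm
    simp only [seedDist, ENNReal.rpow_one]
    rw [← lintegral_const_mul _ hm]
    refine lintegral_mono fun ξ => ?_
    rw [← inner_sub_right, ← ofReal_norm, ← ofReal_norm, ← ENNReal.ofReal_mul (norm_nonneg _)]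
    exact ENNReal.ofReal_le_ofReal (norm_inner_le_norm _ _)
  have h2 := hst.sum_seedDist_one_le hT hp D
  refine (ENNReal.ofReal_le_ofReal_iff (by positivity)).1 ?_
  rw [ENNReal.ofReal_sum_of_nonneg fun i _ => Finset.sum_nonneg fun j _ => abs_nonneg _]
  calc _ ≤ ∑ i : Fin (n + 1), ∑ j : Fin (n + 1),
        ENNReal.ofReal ‖a‖ * seedDist T 1 (i.removeNth D) (j.removeNth D) :=
        Finset.sum_le_sum fun i _ => by
          rw [ENNReal.ofReal_sum_of_nonneg fun j _ => abs_nonneg _]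
          exact Finset.sum_le_sum fun j _ => h1 i j
    _ ≤ ENNReal.ofReal ‖a‖ * (((n : ℝ≥0∞) + 1) ^ 2 * ENNReal.ofReal β) := by
        simp only [← Finset.mul_sum]
        gcongr
    _ = _ := by
        rw [ENNReal.ofReal_mul (norm_nonneg _), ENNReal.ofReal_mul (by positivity),
          ENNReal.ofReal_pow (by positivity), ENNReal.ofReal_add (by positivity) zero_le_one,
          ENNReal.ofReal_natCast, ENNReal.ofReal_one]

/-- The indicator vector of the first `s` coordinates. -/
def firstCoords (d s : ℕ) : EuclideanSpace ℝ (Fin d) :=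
  WithLp.toLp 2 fun k => if (k : ℕ) < s then 1 else 0

theorem card_filter_lt_eq {s : ℕ} (hsd : s ≤ d) :
    (Finset.univ.filter fun k : Fin d => (k : ℕ) < s).card = s := by
  rw [Fin.card_filter_val_lt, min_eq_right hsd]

theorem norm_firstCoords_sq {s : ℕ} (hsd : s ≤ d) : ‖firstCoords d s‖ ^ 2 = s := by
  rw [EuclideanSpace.norm_sq_eq]
  simp only [firstCoords, Real.norm_eq_abs, sq_abs, ite_pow, one_pow,
    ne_eq, OfNat.ofNat_ne_zero, not_false_eq_true, zero_pow]
  rw [Finset.sum_boole, card_filter_lt_eq hsd]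

/-- The two points `± r • firstCoords d s` of the `ℓ_∞` ball. -/
def twoPoint {r : ℝ} (hr : 0 ≤ r) (s : ℕ) (b : Bool) : SupBall d r :=
  ⟨(r * boolSign b) • firstCoords d s, fun k => by
    simp only [firstCoords, PiLp.smul_apply, smul_eq_mul]
    split_ifs
    · simp [abs_mul, abs_boolSign, abs_of_nonneg hr]
    · simpa using hr⟩

theorem mean_twoPoint {r q : ℝ} (hr : 0 ≤ r) (h0 : 0 ≤ q) (h1 : q ≤ 1) (s : ℕ) :
    mean (finiteLaw (bernWeight q) (bernWeight_nonneg h0 h1) (sum_bernWeight q)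
      (twoPoint (d := d) hr s)) = (r * (2 * q - 1)) • firstCoords d s := by
  ext k
  rw [mean_finiteLaw_apply]
  simp only [Fintype.sum_bool, twoPoint, PiLp.smul_apply, smul_eq_mul, bernWeight, boolSign,
    if_true, Bool.false_eq_true, if_false]
  ring

theorem supRisk_ge_of_stable {r β : ℝ} {s : ℕ} {p : ℝ≥0∞} (hp : 1 ≤ p) (hn : 1 ≤ n) (hs : 1 ≤ s)
    (hsd : s ≤ d) (hr : 0 < r) (hβ : 0 ≤ β) (hβs : β ≤ 1 / 16 * (r * √(s : ℝ) / n))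
    {T : Estimator (SupBall d r) n d} (hT : Measurable T) (hst : IsLpStable T p β) :
    ENNReal.ofReal (1 / 16 * (r ^ 2 * s)) ≤ supRisk (sparseClass d r s) mean T := by
  by_contra! hcon
  have hn' : (1 : ℝ) ≤ n := by exact_mod_cast hn
  have hs' : (0 : ℝ) < s := by exact_mod_cast hs
  set a := firstCoords d s with ha
  have hasq : ‖a‖ ^ 2 = s := norm_firstCoords_sq hsd
  have hanorm : ‖a‖ = √(s : ℝ) := by rw [← hasq, Real.sqrt_sq (norm_nonneg _)]
  have hrisk : ∀ q : ℝ, ∀ h0 : 0 < q, ∀ h1 : q < 1,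
      risk T (finiteLaw (bernWeight q) (fun b => (bernWeight_pos h0 h1 b).le) (sum_bernWeight q)
        (twoPoint (d := d) hr.le s)) ((r * (2 * q - 1)) • a) <
        ENNReal.ofReal (1 / 16 * (r ^ 2 * s)) := fun q h0 h1 => by
    rw [ha, ← mean_twoPoint hr.le h0.le h1.le s]
    refine lt_of_le_of_lt (le_iSup₂ (f := fun P (_ : P ∈ sparseClass d r s) => risk T P (mean P))
      _ ?_) hcon
    change sparsity _ ≤ s
    rw [mean_twoPoint hr.le h0.le h1.le s]
    refine (Finset.card_le_card fun k => ?_).trans (card_filter_lt_eq hsd).le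
    rw [Finset.mem_filter, Finset.mem_filter]
    refine fun hk => ⟨hk.1, ?_⟩
    by_contra hcon'
    refine hk.2 ?_
    rw [PiLp.smul_apply, firstCoords, PiLp.toLp_apply, if_neg hcon', smul_zero]
  set t : (Fin n → Bool) → ℝ := fun Z => ∫ ξ : I, ⟪a, T (fun i => twoPoint hr.le s (Z i), ξ)⟫
    with ht
  -- Here ‖a‖² = s, so the squared bias is at most s · r²s/16 = (rs/4)².
  have hbias : ∀ q : ℝ, 0 < q → q < 1 →
      |∑ Z : Fin n → Bool, (∏ i, bernWeight q (Z i)) * t Z - r * (2 * q - 1) * s| ≤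
        r * s / 4 := fun q h0 h1 => by
    have h := sq_bias_le (bernWeight_pos h0 h1) (sum_bernWeight q) hT (hrisk q h0 h1) a
    rw [real_inner_smul_right, real_inner_self_eq_norm_sq, hasq] at h
    refine abs_le_of_sq_le_sq (h.trans_eq ?_) (by positivity)
    ring
  have hint : ∀ Z : Fin n → Bool,
      Integrable (fun ξ : I => T (fun i => twoPoint hr.le s (Z i), ξ)) volume := fun Z => by
    have h := (memLp_sub_of_risk_lt (bernWeight_pos (q := 1 / 2) (by norm_num) (by norm_num))
      (sum_bernWeight _) hT ((hrisk (1 / 2) (by norm_num) (by norm_num)).trans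
        ENNReal.ofReal_lt_top) Z).integrable one_le_two
    simpa using h.add (integrable_const ((r * (2 * (1 / 2) - 1)) • a))
  have hG := bernoulli_mean_sub_le (t := t) fun D =>
    sum_abs_integral_inner_sub_le hT hp hβ hst a (fun i => twoPoint hr.le s (D i))
      fun i => hint (i.removeNth D)
  have hfin : 4 / 3 * (‖a‖ * ((n + 1) ^ 2 * β) / (n + 1)) ≤ r * s / 6 := by
    have h1 : 4 / 3 * (‖a‖ * (((n : ℝ) + 1) ^ 2 * β) / (n + 1)) =
        4 / 3 * (√(s : ℝ) * ((n + 1) * β)) := by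
      rw [hanorm]
      field_simp
    rw [h1]
    -- The factor n + 1 is absorbed by n + 1 ≤ 2n.
    calc _ ≤ 4 / 3 * (√(s : ℝ) * ((2 * n) * (1 / 16 * (r * √(s : ℝ) / n)))) := by
          gcongr
          linarith
      _ = r * (√(s : ℝ) * √(s : ℝ)) / 6 := by
          field_simp
          ring
      _ = _ := by rw [Real.mul_self_sqrt hs'.le]
  -- The targets at q = 3/4 and q = 1/4 are rs/2 and -rs/2. With bias at most rs/4 each, the
  -- expectations differ by at least rs/2, against at most rs/6 from stability.
  have h1 := (abs_le.1 (hbias (3 / 4) (by norm_num) (by norm_num))).1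
  have h2 := (abs_le.1 (hbias (1 / 4) (by norm_num) (by norm_num))).2
  have h3 : 0 < r * s := by positivity
  linarith

end StableLowerBound

/-! ### Minimax upper bound from the soft-thresholding estimator -/

section Minimax

variable {n d s : ℕ} {r β : ℝ} {p : ℝ≥0∞}

theorem sparseMinimaxRisk_le_softThreshold (hp : 1 ≤ p) (hn : 1 ≤ n) (hs : 1 ≤ s) (hr : 0 < r)
    (hβ : 0 ≤ β) : sparseMinimaxRisk n p d r s β ≤
      supRisk (sparseClass d r s) mean (softThreshold n d r s β) :=
  iInf_le_of_le _ (iInf_le_of_le (measurable_softThreshold s β)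
    (iInf_le_of_le ((isLpStable_softThreshold hp hn hs hr hβ).mono (min_le_left _ _)) le_rfl))

end Minimax

end StableMean

end

theorem theorem8 :
    ∃ (C : ℝ) (c : ℝ) (cK : ℝ → ℝ), 0 < C ∧ 0 < c ∧ (∀ K : ℝ, 0 < K → 0 < cK K) ∧
      ∀ (p : ℝ≥0∞) (n d s : ℕ) (r β : ℝ),
        1 ≤ p → 1 ≤ n → 1 ≤ s → s ≤ d → 0 < r → 0 ≤ β →
        -- large stability budget: the minimax rate, upper and lower bound
        (2 ≤ d → 4 * √2 * (r * √(s : ℝ) / n) ≤ β →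
          StableMean.sparseMinimaxRisk n p d r s β
              ≤ ENNReal.ofReal (C * (r ^ 2 * s * Real.log d / n)) ∧
          ∀ K : ℝ, 0 < K →
            Real.log d ≤ K * Real.log (Real.exp 1 * d / s) → Real.log d ≤ K * n →
            ENNReal.ofReal (cK K * (r ^ 2 * s * Real.log d / n))
              ≤ StableMean.sparseMinimaxRisk n p d r s β) ∧
        -- small stability budget
        (β ≤ 1 / 16 * (r * √(s : ℝ) / n) →
          StableMean.sparseMinimaxRisk n p d r s β ≤ ENNReal.ofReal (C * (r ^ 2 * s)) ∧
          ENNReal.ofReal (c * (r ^ 2 * s)) ≤ StableMean.sparseMinimaxRisk n p d r s β) ∧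
        -- the soft-thresholding estimator is admissible, stable at a level free of `d`,
        -- and attains both rates
        Measurable (StableMean.softThreshold n d r s β) ∧
        StableMean.IsWorstCaseStable (StableMean.softThreshold n d r s β)
          (min β (4 * √2 * (r * √(s : ℝ) / n))) ∧
        StableMean.IsLpStable (StableMean.softThreshold n d r s β) p
          (min β (4 * √2 * (r * √(s : ℝ) / n))) ∧
        (2 ≤ d → 4 * √2 * (r * √(s : ℝ) / n) ≤ β →
          StableMean.supRisk (StableMean.sparseClass d r s) StableMean.mean
              (StableMean.softThreshold n d r s β)
            ≤ ENNReal.ofReal (C * (r ^ 2 * s * Real.log d / n))) ∧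
        (β ≤ 1 / 16 * (r * √(s : ℝ) / n) →
          StableMean.supRisk (StableMean.sparseClass d r s) StableMean.mean
              (StableMean.softThreshold n d r s β)
            ≤ ENNReal.ofReal (C * (r ^ 2 * s))) := by
  refine ⟨64, 1 / 16, fun K => 1 / (40 * K), by norm_num, by norm_num, fun K hK => by positivity,
    fun p n d s r β hp hn hs hsd hr hβ => ?_⟩
  have hle := StableMean.sparseMinimaxRisk_le_softThreshold (d := d) hp hn hs hr hβ
  have hlarge := fun (hd : 2 ≤ d) (h : 4 * √2 * (r * √(s : ℝ) / n) ≤ β) =>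
    StableMean.supRisk_softThreshold_le_of_large hd hn hs hr h
  have hsmall : StableMean.supRisk (StableMean.sparseClass d r s) StableMean.mean
      (StableMean.softThreshold n d r s β) ≤ ENNReal.ofReal (64 * (r ^ 2 * s)) :=
    (StableMean.supRisk_softThreshold_le_of_small hn hr hβ).trans (ENNReal.ofReal_le_ofReal
      (mul_le_mul_of_nonneg_right (by norm_num) (by positivity)))
  refine ⟨fun hd h => ⟨hle.trans (hlarge hd h), fun K hK h1 h2 => ?_⟩,
    fun h => ⟨hle.trans hsmall, ?_⟩, StableMean.measurable_softThreshold s β,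
    StableMean.isWorstCaseStable_softThreshold hn hs hr hβ,
    StableMean.isLpStable_softThreshold hp hn hs hr hβ, hlarge, fun _ => hsmall⟩
  · exact le_iInf fun T => le_iInf fun hT => le_iInf fun _ =>
      StableMean.supRisk_ge_of_log_le hd hn hs hsd hr hK h1 h2 hT
  · exact le_iInf fun T => le_iInf fun hT => le_iInf fun hst =>
      StableMean.supRisk_ge_of_stable hp hn hs hsd hr hβ h hT hst
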